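/- Let $(X,d)$ be a compact metric space with its Borel $\sigma$-algebra, let $P(X)$ be the set of Borel probability measures on $X$, and let $\mathrm{Lip}(X)$ be the set of Lipschitz functions $f:X\to\mathbb{R}$; for $x_0\in X$ put $\mathrm{Lip}(X,x_0)=\{f\in \mathrm{Lip}(X): f(x_0)=0\}$. Let $\phi:\mathbb{R}\to[-\infty,\infty]$ be proper, convex and lower semicontinuous with $\phi(1)=0$, with $1$ in the relative interior of $\operatorname{dom}\phi=\{\phi<\infty\}$, and strictly convex at $1$, i.e. $\lambda\phi(x_1)+(1-\lambda)\phi(x_2)>\phi(1)$ whenever $\lambda\in(0,1)$, $x_1,x_2\in\operatorname{dom}\phi$, $\lambda x_1+(1-\lambda)x_2=1$ and not $x_1=x_2=1$. Put $\phi'(\infty)=\lim_{x\to\infty}\phi(x)/x\in(-\infty,\infty]$ and $\phi_+^*(y)=\sup_{x\ge 0}\{xy-\phi(x)\}$, the convex conjugate of $\phi_+=\phi+i_{[0,\infty)}$, where $i_{[0,\infty)}$ is $0$ on $[0,\infty)$ and $\infty$ elsewhere. For $\mu,\nu\in P(X)$ with Lebesgue decomposition $\mu=\mu_c+\mu_s$,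 $\mu_c\ll\nu$, $\mu_s\perp\nu$, let \[ D_\phi(\mu\Vert\nu)=\int\phi\circ\frac{d\mu_c}{d\nu}\,d\nu+\phi'(\infty)\,\mu_s(X) \] (with $\infty\cdot 0=0$), and for $f\in\mathrm{Lip}(X)$ let \[ D_\phi^*(f\Vert\nu)=\sup_{\xi\in P(X)}\left\{\int f\,d\xi-D_\phi(\xi\Vert\nu)\right\}. \] Then for all $\mu,\nu\in P(X)$ and every $x_0\in X$, \[ D_\phi(\mu\Vert\nu)=\sup_{f\in \mathrm{Lip}(X)}\left\{\int f\,d\mu-D_\phi^*(f\Vert\nu)\right\}=\sup_{f\in \mathrm{Lip}(X,x_0)}\left\{\int f\,d\mu-D_\phi^*(f\Vert\nu)\right\}, \] and for every $f\in\mathrm{Lip}(X)$ the value $D_\phi^*(f\Vert\nu)$ is a real number and \[ D_\phi^*(f\Vert\nu)=\min\left\{\int\phi_+^*\circ(f-\gamma)\,d\nu+\gamma \;:\; \gamma\in\mathbb{R},\ \gamma\ge\sup f(X)-\phi'(\infty)\right\}, \] where the minimum is attained. -/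

import Mathlib

open MeasureTheory Filter
open scoped NNReal ENNReal

noncomputable section

namespace FDivergence

/-! ### Convex analysis of functions `φ : ℝ → [-∞, ∞]` -/

/-- The effective domain. -/
def effDom (φ : ℝ → EReal) : Set ℝ := {x | φ x < ⊤}

/-- `φ` is proper: its effective domain is nonempty and it never takes the value `-∞`. -/
def IsProper (φ : ℝ → EReal) : Prop := (effDom φ).Nonempty ∧ ∀ x, ⊥ < φ x

/-- Convexity of an extended real valued function
(in `EReal`, `0 * ⊤ = 0`, so `l = 0` and `l = 1` impose nothing). -/
def IsConvex (φ : ℝ → EReal) : Prop :=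
  ∀ x y l : ℝ, 0 ≤ l → l ≤ 1 →
    φ (l * x + (1 - l) * y) ≤ (l : EReal) * φ x + ((1 - l : ℝ) : EReal) * φ y

/-- Strict convexity at a single point `a`. -/
def IsStrictlyConvexAt (φ : ℝ → EReal) (a : ℝ) : Prop :=
  a ∈ effDom φ ∧
    ∀ l : ℝ, 0 < l → l < 1 → ∀ x ∈ effDom φ, ∀ y ∈ effDom φ,
      l * x + (1 - l) * y = a → ¬ (x = a ∧ y = a) →
        φ a < (l : EReal) * φ x + ((1 - l : ℝ) : EReal) * φ y

/-- The convex-analytic indicator `i_A`: `0` on `A` and `∞` off `A`. -/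
def convexIndicator (A : Set ℝ) (x : ℝ) : EReal :=
  open Classical in if x ∈ A then 0 else ⊤

/-- `φ₊ = φ + i_{[0, ∞)}`. -/
def plusPart (φ : ℝ → EReal) (x : ℝ) : EReal := φ x + convexIndicator (Set.Ici 0) x

/-- The convex conjugate `φ^*(y) = sup_x (x y - φ(x))`. -/
def conjugate (φ : ℝ → EReal) (y : ℝ) : EReal := ⨆ x : ℝ, (((x * y : ℝ) : EReal) - φ x)

/-- `φ'(∞) = lim_{x → ∞} φ(x) / x`. The limit exists in `[-∞, ∞]` whenever `φ` is proper and
convex. -/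
def slopeAtTop (φ : ℝ → EReal) : EReal := limUnder atTop (fun x : ℝ => φ x / (x : EReal))

/-! ### Integrals and divergences -/

variable {X : Type*}

/-- The Lebesgue integral of an extended real valued function: the integral of the positive part
minus the integral of the negative part. -/
def eintegral [MeasurableSpace X] (ν : Measure X) (g : X → EReal) : EReal :=
  ((∫⁻ x, (g x).toENNReal ∂ν : ℝ≥0∞) : EReal) - ((∫⁻ x, (-g x).toENNReal ∂ν : ℝ≥0∞) : EReal)

/-- The `f`-divergence `D_φ(μ ‖ ν) = ∫ φ(dμ_c/dν) dν + φ'(∞) μ_s(X)` of nonnegative measures, where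
`μ = μ_c + μ_s` is the Lebesgue decomposition with respect to `ν`. -/
def fDiv [MeasurableSpace X] (φ : ℝ → EReal) (μ ν : Measure X) : EReal :=
  eintegral ν (fun x => φ (μ.rnDeriv ν x).toReal)
    + slopeAtTop φ * ((μ.singularPart ν Set.univ : ℝ≥0∞) : EReal)

/-- The tight convex conjugate
`D_φ^*(f ‖ ν) = sup { ∫ f dξ - D_φ(ξ ‖ ν) : ξ a probability measure }`. -/
def tightConj [MeasurableSpace X] (φ : ℝ → EReal) (ν : Measure X) (f : X → ℝ) : EReal :=
  ⨆ ξ : ProbabilityMeasure X,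
    (((∫ x, f x ∂(ξ : Measure X) : ℝ) : EReal) - fDiv φ (ξ : Measure X) ν)

/-- `Lip(X)`: the Lipschitz functions `X → ℝ`. -/
def Lip (X : Type*) [MetricSpace X] : Set (X → ℝ) := {f | ∃ K : ℝ≥0, LipschitzWith K f}

/-- `Lip(X, x₀)`: the Lipschitz functions `X → ℝ` that vanish at `x₀`. -/
def LipAt [MetricSpace X] (x₀ : X) : Set (X → ℝ) := {f | f ∈ Lip X ∧ f x₀ = 0}

end FDivergence

end

/-! Passing from `φ` to `φ₊` changes neither the divergence nor the slope at infinity, so one may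
assume that `φ` is carried by `[0, ∞)`; its conjugate is then nondecreasing, and finite below
`φ'(∞)`.

By Fenchel–Moreau, `φ r` is the supremum of `r y - c` over the `(y, c)` with `φ^* y ≤ c` and `y <
φ'(∞)`. Choosing nearly optimal pairs measurably, among finitely many, shows that `D_φ(ξ ‖ ν)` is
the supremum of `∫ g dξ - ∫ φ^* ∘ g dν` over the bounded measurable `g` that stay away from `φ'(∞)`.
Lipschitz functions are dense enough to restrict `g` to them, and weak duality with `γ = -g x₀`,
applied to `f = g - g x₀`, then gives both supremum formulas.

For the minimum formula, the pairs `(ξ(X), v)` with `v ≤ ∫ f dξ - D_φ(ξ ‖ ν)`, `ξ` a finite measure,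
form a convex set whose slice at mass `1` has supremum `D_φ^*(f ‖ ν)`. Since `1` is in the relative
interior of the domain of `φ`, this set lies below a line through the point `(1, D_φ^*(f ‖ ν))`,
whose slope is the optimal `γ`: adding multiples of a Dirac mass to `ξ` gives `f - γ ≤ φ'(∞)`, and
running through the measures `ρ ν` bounds `∫ φ^* ∘ (f - γ) dν`. -/

namespace FDivergence

section ConvexAnalysis

variable {φ : ℝ → EReal} {p : ℝ × ℝ} {x y r c M : ℝ}

lemma coe_sub_le_comm {a : ℝ} {b c : EReal} : (a : EReal) - b ≤ c ↔ (a : EReal) - c ≤ b := by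
  induction b <;> induction c <;> simp [← EReal.coe_sub, add_comm]

lemma mem_effDom_of_le_coe (h : φ x ≤ (c : EReal)) : x ∈ effDom φ :=
  h.trans_lt (EReal.coe_lt_top c)

/-- The epigraph of `φ`, as a subset of the plane. -/
def epi (φ : ℝ → EReal) : Set (ℝ × ℝ) := {p | φ p.1 ≤ p.2}

lemma mem_epi : p ∈ epi φ ↔ φ p.1 ≤ p.2 := Iff.rfl

lemma mul_sub_le_conjugate (hp : p ∈ epi φ) (y : ℝ) :
    ((y * p.1 - p.2 : ℝ) : EReal) ≤ conjugate φ y := by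
  rw [mul_comm, EReal.coe_sub]
  exact (EReal.sub_le_sub le_rfl hp).trans
    (le_iSup (fun x : ℝ => ((x * y : ℝ) : EReal) - φ x) p.1)

lemma conjugate_eq_iSup_epi (φ : ℝ → EReal) (y : ℝ) :
    conjugate φ y = ⨆ p : epi φ, ((y * p.1.1 - p.1.2 : ℝ) : EReal) := by
  refine le_antisymm (iSup_le fun x => EReal.ge_of_forall_gt_iff_ge.1 fun z hz => ?_)
    (iSup_le fun p => mul_sub_le_conjugate p.2 y)
  have hp : (x, x * y - z) ∈ epi φ := by
    rw [mem_epi, EReal.coe_sub]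
    by_contra! h
    exact hz.not_ge (coe_sub_le_comm.1 h.le)
  simpa [mul_comm y] using
    le_iSup (fun p : epi φ => ((y * p.1.1 - p.1.2 : ℝ) : EReal)) ⟨_, hp⟩

lemma conjugate_le_iff {s : EReal} :
    conjugate φ y ≤ s ↔ ∀ p ∈ epi φ, ((y * p.1 - p.2 : ℝ) : EReal) ≤ s := by
  rw [conjugate_eq_iSup_epi, iSup_le_iff, Subtype.forall]

lemma mem_epi_conjugate {q : ℝ × ℝ} :
    q ∈ epi (conjugate φ) ↔ ∀ p ∈ epi φ, q.1 * p.1 - q.2 ≤ p.2 := by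
  simp only [mem_epi, conjugate_le_iff, EReal.coe_le_coe_iff]
  exact forall₂_congr fun _ _ => sub_le_comm

lemma conjugate_conjugate_le (φ : ℝ → EReal) (x : ℝ) : conjugate (conjugate φ) x ≤ φ x :=
  iSup_le fun y => coe_sub_le_comm.1 <| by
    rw [mul_comm]
    exact le_iSup (fun x : ℝ => ((x * y : ℝ) : EReal) - φ x) x

lemma IsConvex.convex_epi (hφ : IsConvex φ) : Convex ℝ (epi φ) := by
  rintro ⟨x, c⟩ hc ⟨y, d⟩ hd a b ha hb hab
  obtain rfl : b = 1 - a := by linarith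
  refine (hφ x y a ha (by linarith)).trans ?_
  simp only [Prod.smul_mk, Prod.mk_add_mk, smul_eq_mul, EReal.coe_add, EReal.coe_mul]
  exact add_le_add (mul_le_mul_of_nonneg_left hc (by exact_mod_cast ha))
    (mul_le_mul_of_nonneg_left hd (by exact_mod_cast hb))

lemma isClosed_epi (hφ : LowerSemicontinuous φ) : IsClosed (epi φ) :=
  hφ.isClosed_epigraph.preimage
    (continuous_fst.prodMk (continuous_coe_real_ereal.comp continuous_snd))

/-- Closed proper convex functions on the line: those for which Fenchel duality is an involution.
Convexity is phrased through the epigraph, which avoids the convention `0 * ⊤ = 0`. -/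
structure IsClosedConvex (φ : ℝ → EReal) : Prop where
  proper : IsProper φ
  convex_epi : Convex ℝ (epi φ)
  lsc : LowerSemicontinuous φ

namespace IsClosedConvex

variable (hφ : IsClosedConvex φ)
include hφ

lemma exists_mem_epi : ∃ p, p ∈ epi φ := by
  obtain ⟨x, hx⟩ := hφ.proper.1
  exact ⟨(x, (φ x).toReal), EReal.le_coe_toReal (ne_of_lt hx)⟩

lemma exists_separating (hM : (M : EReal) < φ r) :
    ∃ a b u : ℝ, 0 ≤ b ∧ a * r + b * M < u ∧ ∀ p ∈ epi φ, u < a * p.1 + b * p.2 := by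
  obtain ⟨f, u, hu, hf⟩ := geometric_hahn_banach_point_closed hφ.convex_epi (isClosed_epi hφ.lsc)
    (show (r, M) ∉ epi φ from hM.not_ge)
  have f_apply (p : ℝ × ℝ) : f p = f (1, 0) * p.1 + f (0, 1) * p.2 := by
    rw [show p = p.1 • ((1, 0) : ℝ × ℝ) + p.2 • ((0, 1) : ℝ × ℝ) by ext <;> simp]
    rw [map_add, map_smul, map_smul]
    simp [mul_comm]
  refine ⟨f (1, 0), f (0, 1), u, ?_, f_apply (r, M) ▸ hu, fun p hp => f_apply p ▸ hf p hp⟩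
  obtain ⟨⟨x, t⟩, hp⟩ := hφ.exists_mem_epi
  have hray : ∀ s : ℝ, 0 ≤ s → u < f (x, t) + s * f (0, 1) := fun s hs => by
    have hs : (x, t + s) ∈ epi φ :=
      mem_epi.2 (hp.trans (EReal.coe_le_coe_iff.2 (le_add_of_nonneg_right hs)))
    have := hf _ hs
    rw [f_apply] at this ⊢
    linarith
  by_contra! hb
  have h := hray ((f (x, t) - u) / -f (0, 1))
    (div_nonneg (by linarith [hray 0 le_rfl]) (by linarith))
  rw [div_mul_eq_mul_div, div_neg, mul_div_cancel_right₀ _ hb.ne] at h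
  linarith

omit hφ in
lemma mem_epi_conjugate_of_separating {a b u : ℝ} (hb : 0 < b)
    (h : ∀ p ∈ epi φ, u < a * p.1 + b * p.2) : (-a / b, -u / b) ∈ epi (conjugate φ) :=
  mem_epi_conjugate.2 fun p hp => by
    rw [div_mul_eq_mul_div, ← sub_div, div_le_iff₀ hb]
    linarith [h p hp]

lemma exists_mem_epi_conjugate : ∃ q, q ∈ epi (conjugate φ) := by
  obtain ⟨⟨x, t⟩, hp⟩ := hφ.exists_mem_epi
  obtain ⟨s, -, hs⟩ := EReal.lt_iff_exists_real_btwn.1 (hφ.proper.2 x)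
  obtain ⟨a, b, u, hb, hsu, hu⟩ := hφ.exists_separating hs
  have hst : s < t := by exact_mod_cast hs.trans_le hp
  have hb : 0 < b := by
    have := hu _ hp
    exact hb.lt_of_ne' fun h => by subst h; linarith [hst]
  exact ⟨_, mem_epi_conjugate_of_separating hb hu⟩

lemma exists_mem_epi_conjugate_lt (hM : (M : EReal) < φ r) :
    ∃ q ∈ epi (conjugate φ), M < r * q.1 - q.2 := by
  obtain ⟨a, b, u, hb, hMu, hu⟩ := hφ.exists_separating hM
  rcases hb.eq_or_lt with rfl | hb
  · -- A vertical separating line tilts a non-vertical one arbitrarily far.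
    obtain ⟨⟨y, c⟩, hq⟩ := hφ.exists_mem_epi_conjugate
    have hpos : 0 < u - a * r := by linarith
    obtain ⟨k, hk⟩ := exists_nat_gt ((M - (r * y - c)) / (u - a * r))
    rw [div_lt_iff₀ hpos] at hk
    refine ⟨(y - k * a, c - k * u), mem_epi_conjugate.2 fun p hp => ?_, by linarith⟩
    have hkp : 0 ≤ k * (a * p.1 - u) := mul_nonneg k.cast_nonneg (by linarith [hu p hp])
    linarith [mem_epi_conjugate.1 hq p hp]
  · refine ⟨_, mem_epi_conjugate_of_separating hb hu, ?_⟩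
    rw [mul_div_assoc', ← sub_div, lt_div_iff₀ hb]
    linarith

theorem conjugate_conjugate (r : ℝ) : conjugate (conjugate φ) r = φ r := by
  refine (conjugate_conjugate_le φ r).antisymm (EReal.ge_of_forall_gt_iff_ge.1 fun M hM => ?_)
  obtain ⟨q, hq, hMq⟩ := hφ.exists_mem_epi_conjugate_lt hM
  exact le_trans (by exact_mod_cast hMq.le) (mul_sub_le_conjugate hq r)

lemma bot_lt_conjugate (y : ℝ) : ⊥ < conjugate φ y := by
  obtain ⟨p, hp⟩ := hφ.exists_mem_epi
  exact (EReal.bot_lt_coe _).trans_le (mul_sub_le_conjugate hp y)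

end IsClosedConvex

lemma tendsto_coe_sub_div_atTop (a b : ℝ) :
    Tendsto (fun x : ℝ => ((a - b / x : ℝ) : EReal)) atTop (nhds (a : EReal)) := by
  refine (continuous_coe_real_ereal.tendsto a).comp ?_
  simpa using tendsto_const_nhds.sub (tendsto_const_nhds.div_atTop (tendsto_id (α := ℝ)))

lemma coe_sub_div_le_div {q : ℝ × ℝ} (hq : q ∈ epi (conjugate φ)) (hx : 0 < x) :
    ((q.1 - q.2 / x : ℝ) : EReal) ≤ φ x / x := by
  rw [EReal.le_div_iff_mul_le (by exact_mod_cast hx) (EReal.coe_ne_top x), ← EReal.coe_mul,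
    sub_mul, div_mul_cancel₀ _ hx.ne', mul_comm]
  exact (mul_sub_le_conjugate hq x).trans (conjugate_conjugate_le φ x)

namespace IsClosedConvex

variable (hφ : IsClosedConvex φ)
include hφ

lemma le_mul_sub_of_effDom_conjugate_le {σ : ℝ} (hσ : ∀ y ∈ effDom (conjugate φ), y ≤ σ)
    (hp : p ∈ epi φ) (hx : p.1 ≤ x) : φ x ≤ ((x * σ - (p.1 * σ - p.2) : ℝ) : EReal) := by
  rw [← hφ.conjugate_conjugate, conjugate_le_iff]
  intro q hq
  have := mem_epi_conjugate.1 hq p hp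
  have := mul_le_mul_of_nonneg_left (hσ q.1 (mem_effDom_of_le_coe hq)) (sub_nonneg.2 hx)
  exact_mod_cast (by linarith : x * q.1 - q.2 ≤ x * σ - (p.1 * σ - p.2))

lemma tendsto_div_atTop :
    Tendsto (fun x : ℝ => φ x / x) atTop (nhds (⨆ y ∈ effDom (conjugate φ), (y : EReal))) := by
  refine tendsto_order.2 ⟨fun a ha => ?_, fun a ha => ?_⟩
  · obtain ⟨y, hy, hay⟩ := lt_biSup_iff.1 ha
    have hq : (y, (conjugate φ y).toReal) ∈ epi (conjugate φ) :=
      EReal.le_coe_toReal (ne_of_lt hy)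
    filter_upwards [(tendsto_coe_sub_div_atTop _ _).eventually_const_lt hay,
      eventually_gt_atTop 0] with x hax hx
    exact hax.trans_le (coe_sub_div_le_div hq hx)
  · obtain ⟨σ, hσ, hσa⟩ := EReal.lt_iff_exists_real_btwn.1 ha
    obtain ⟨p, hp⟩ := hφ.exists_mem_epi
    filter_upwards [(tendsto_coe_sub_div_atTop σ (p.1 * σ - p.2)).eventually_lt_const hσa,
      eventually_gt_atTop 0, eventually_ge_atTop p.1] with x hxa hx hpx
    refine lt_of_le_of_lt ?_ hxa
    have hle := hφ.le_mul_sub_of_effDom_conjugate_le (σ := σ)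
      (fun y hy => by exact_mod_cast (le_biSup (fun y : ℝ => (y : EReal)) hy).trans hσ.le)
      hp hpx
    rw [EReal.div_le_iff_le_mul (by exact_mod_cast hx) (EReal.coe_ne_top x), ← EReal.coe_mul,
      mul_sub, mul_div_cancel₀ _ hx.ne']
    exact hle

lemma slopeAtTop_eq : slopeAtTop φ = ⨆ y ∈ effDom (conjugate φ), (y : EReal) :=
  hφ.tendsto_div_atTop.limUnder_eq

lemma le_slopeAtTop (hy : y ∈ effDom (conjugate φ)) : (y : EReal) ≤ slopeAtTop φ := by
  rw [hφ.slopeAtTop_eq]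
  exact le_biSup (fun y : ℝ => (y : EReal)) hy

lemma bot_lt_slopeAtTop : ⊥ < slopeAtTop φ := by
  obtain ⟨q, hq⟩ := hφ.exists_mem_epi_conjugate
  exact (EReal.bot_lt_coe q.1).trans_le (hφ.le_slopeAtTop (mem_effDom_of_le_coe hq))

lemma exists_lt_slopeAtTop : ∃ y : ℝ, (y : EReal) < slopeAtTop φ :=
  let ⟨y, _, hy⟩ := EReal.lt_iff_exists_real_btwn.1 hφ.bot_lt_slopeAtTop
  ⟨y, hy⟩

end IsClosedConvex

/-- Entropy functions: closed proper convex functions carried by the half line `[0, ∞)`. Among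
these, the conjugate is nondecreasing and finite below `φ'(∞)`. -/
structure IsEntropy (φ : ℝ → EReal) : Prop extends IsClosedConvex φ where
  eq_top_of_neg : ∀ x < 0, φ x = ⊤

/-- The part of the epigraph of the conjugate of `φ` lying strictly to the left of `φ'(∞)`. -/
def dualEpi (φ : ℝ → EReal) : Set (ℝ × ℝ) :=
  {q | (q.1 : EReal) < slopeAtTop φ ∧ q ∈ epi (conjugate φ)}

namespace IsEntropy

variable (hφ : IsEntropy φ)
include hφ

lemma nonneg_of_mem_epi (hp : p ∈ epi φ) : 0 ≤ p.1 := by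
  by_contra! h
  rw [mem_epi, hφ.eq_top_of_neg _ h] at hp
  exact (EReal.coe_lt_top _).not_ge hp

lemma monotone_conjugate : Monotone (conjugate φ) := fun y z hyz =>
  conjugate_le_iff.2 fun p hp => (mul_sub_le_conjugate hp z).trans' <| by
    exact_mod_cast sub_le_sub_right (mul_le_mul_of_nonneg_right hyz (hφ.nonneg_of_mem_epi hp)) _

lemma conjugate_lt_top (hy : (y : EReal) < slopeAtTop φ) : conjugate φ y < ⊤ := by
  rw [hφ.slopeAtTop_eq] at hy
  obtain ⟨z, hz, hyz⟩ := lt_biSup_iff.1 hy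
  exact (hφ.monotone_conjugate (by exact_mod_cast hyz.le)).trans_lt hz

lemma coe_toReal_conjugate (hy : (y : EReal) < slopeAtTop φ) :
    ((conjugate φ y).toReal : EReal) = conjugate φ y :=
  EReal.coe_toReal (hφ.conjugate_lt_top hy).ne (hφ.bot_lt_conjugate y).ne'

lemma toReal_conjugate_le_iff (hy : (y : EReal) < slopeAtTop φ) :
    (conjugate φ y).toReal ≤ c ↔ ∀ p ∈ epi φ, y * p.1 - p.2 ≤ c := by
  rw [← EReal.coe_le_coe_iff, hφ.coe_toReal_conjugate hy, conjugate_le_iff]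
  simp only [EReal.coe_le_coe_iff]

lemma exists_mem_dualEpi_lt (hM : (M : EReal) < φ r) : ∃ q ∈ dualEpi φ, M < r * q.1 - q.2 := by
  obtain ⟨⟨y, c⟩, hq, hM⟩ := hφ.exists_mem_epi_conjugate_lt hM
  have hcont : ContinuousAt (fun z : ℝ => r * z - c) y := by fun_prop
  obtain ⟨z, hz, hzy⟩ := ((hcont.tendsto.mono_left nhdsWithin_le_nhds).eventually_const_lt hM
    |>.and (self_mem_nhdsWithin (s := Set.Iio y))).exists
  have hzy : z < y := hzy
  exact ⟨(z, c), ⟨(EReal.coe_lt_coe_iff.2 hzy).trans_le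
    (hφ.le_slopeAtTop (mem_effDom_of_le_coe hq)), (hφ.monotone_conjugate hzy.le).trans hq⟩, hz⟩

lemma eq_iSup_dualEpi (r : ℝ) :
    φ r = ⨆ q : dualEpi φ, ((r * q.1.1 - q.1.2 : ℝ) : EReal) := by
  refine le_antisymm (EReal.ge_of_forall_gt_iff_ge.1 fun M hM => ?_) (iSup_le fun q => ?_)
  · obtain ⟨q, hq, hMq⟩ := hφ.exists_mem_dualEpi_lt hM
    exact le_trans (by exact_mod_cast hMq.le)
      (le_iSup (fun q : dualEpi φ => ((r * q.1.1 - q.1.2 : ℝ) : EReal)) ⟨q, hq⟩)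
  · exact (mul_sub_le_conjugate q.2.2 r).trans (conjugate_conjugate_le φ r)

lemma continuousOn_toReal_conjugate :
    ContinuousOn (fun y => (conjugate φ y).toReal) {y : ℝ | (y : EReal) < slopeAtTop φ} := by
  have hord : Set.OrdConnected {y : ℝ | (y : EReal) < slopeAtTop φ} :=
    ⟨fun _ _ _ hy _ hz => (EReal.coe_le_coe_iff.2 hz.2).trans_lt hy⟩
  refine ConvexOn.continuousOn (isOpen_lt continuous_coe_real_ereal continuous_const)
    ⟨hord.convex, fun x hx y hy a b ha hb hab => ?_⟩
  rw [hφ.toReal_conjugate_le_iff (hord.convex hx hy ha hb hab)]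
  intro p hp
  have hxp := mul_le_mul_of_nonneg_left ((hφ.toReal_conjugate_le_iff hx).1 le_rfl p hp) ha
  have hyp := mul_le_mul_of_nonneg_left ((hφ.toReal_conjugate_le_iff hy).1 le_rfl p hp) hb
  simp only [smul_eq_mul]
  linear_combination hxp + hyp + p.2 * hab

lemma toReal_conjugate_mem_Icc {a b : ℝ} (hb : (b : EReal) < slopeAtTop φ)
    (hy : y ∈ Set.Icc a b) :
    (conjugate φ y).toReal ∈ Set.Icc (conjugate φ a).toReal (conjugate φ b).toReal := by
  have hyb : (y : EReal) < slopeAtTop φ := (EReal.coe_le_coe_iff.2 hy.2).trans_lt hb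
  exact ⟨EReal.toReal_le_toReal (hφ.monotone_conjugate hy.1) (hφ.bot_lt_conjugate a).ne'
    (hφ.conjugate_lt_top hyb).ne, EReal.toReal_le_toReal (hφ.monotone_conjugate hy.2)
    (hφ.bot_lt_conjugate y).ne' (hφ.conjugate_lt_top hb).ne⟩

end IsEntropy

end ConvexAnalysis

section PlusPart

variable {φ : ℝ → EReal} {x : ℝ}

lemma plusPart_of_nonneg (φ : ℝ → EReal) (hx : 0 ≤ x) : plusPart φ x = φ x := by
  simp [plusPart, convexIndicator, hx]

lemma plusPart_of_neg (hφ : ⊥ < φ x) (hx : x < 0) : plusPart φ x = ⊤ := by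
  simp [plusPart, convexIndicator, hx.not_ge, EReal.add_top_of_ne_bot hφ.ne']

lemma plusPart_le_iff (hφ : ⊥ < φ x) {s : EReal} (hs : s < ⊤) :
    plusPart φ x ≤ s ↔ 0 ≤ x ∧ φ x ≤ s := by
  rcases le_or_gt 0 x with hx | hx
  · simp [plusPart_of_nonneg, hx]
  · simp [plusPart_of_neg hφ hx, hx.not_ge, hs.ne]

lemma isEntropy_plusPart (hbot : ∀ x, ⊥ < φ x) (hconvex : IsConvex φ)
    (hlsc : LowerSemicontinuous φ) (hx₀ : 0 ≤ x) (hx : x ∈ effDom φ) :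
    IsEntropy (plusPart φ) where
  proper := by
    refine ⟨⟨x, (plusPart_of_nonneg φ hx₀).trans_lt hx⟩, fun x => ?_⟩
    rcases le_or_gt 0 x with hx | hx
    · exact (hbot x).trans_eq (plusPart_of_nonneg φ hx).symm
    · simp [plusPart_of_neg (hbot x) hx]
  convex_epi := by
    have h : epi (plusPart φ) = Prod.fst ⁻¹' Set.Ici 0 ∩ epi φ :=
      Set.ext fun p => plusPart_le_iff (hbot p.1) (EReal.coe_lt_top p.2)
    exact h ▸ ((convex_Ici 0).linear_preimage (LinearMap.fst ℝ ℝ ℝ)).inter hconvex.convex_epi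
  lsc := lowerSemicontinuous_iff_isClosed_preimage.2 fun s => by
    rcases eq_top_or_lt_top s with rfl | hs
    · simp
    · have h : plusPart φ ⁻¹' Set.Iic s = Set.Ici 0 ∩ φ ⁻¹' Set.Iic s :=
        Set.ext fun x => plusPart_le_iff (hbot x) hs
      exact h ▸ isClosed_Ici.inter (hlsc.isClosed_preimage s)
  eq_top_of_neg x hx := plusPart_of_neg (hbot x) hx

lemma effDom_plusPart (hbot : ∀ x, ⊥ < φ x) :
    effDom (plusPart φ) = effDom φ ∩ Set.Ici 0 := by
  ext x
  rcases lt_or_ge x 0 with hx | hx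
  · simp [effDom, plusPart_of_neg (hbot x) hx, hx]
  · simp [effDom, plusPart_of_nonneg φ hx, hx]

lemma slopeAtTop_plusPart (φ : ℝ → EReal) : slopeAtTop (plusPart φ) = slopeAtTop φ := by
  have h : (fun x : ℝ => plusPart φ x / (x : EReal)) =ᶠ[atTop] fun x => φ x / (x : EReal) := by
    filter_upwards [eventually_ge_atTop 0] with x hx
    rw [plusPart_of_nonneg φ hx]
  rw [slopeAtTop, slopeAtTop, limUnder, limUnder, map_congr h]

variable {X : Type*} [MeasurableSpace X]

lemma fDiv_plusPart (φ : ℝ → EReal) (μ ν : Measure X) : fDiv (plusPart φ) μ ν = fDiv φ μ ν := by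
  simp only [fDiv, slopeAtTop_plusPart, plusPart_of_nonneg φ ENNReal.toReal_nonneg]

lemma tightConj_plusPart (φ : ℝ → EReal) (ν : Measure X) (f : X → ℝ) :
    tightConj (plusPart φ) ν f = tightConj φ ν f := by
  simp only [tightConj, fDiv_plusPart]

end PlusPart

section Integral

variable {X : Type*} [MeasurableSpace X] {ν : Measure X}

lemma eintegral_mono {g₁ g₂ : X → EReal} (h : ∀ x, g₁ x ≤ g₂ x) :
    eintegral ν g₁ ≤ eintegral ν g₂ :=
  EReal.sub_le_sub
    (EReal.coe_ennreal_le_coe_ennreal_iff.2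
      (lintegral_mono fun x => EReal.toENNReal_le_toENNReal (h x)))
    (EReal.coe_ennreal_le_coe_ennreal_iff.2
      (lintegral_mono fun x => EReal.toENNReal_le_toENNReal (EReal.neg_le_neg_iff.2 (h x))))

lemma eintegral_congr_ae {g₁ g₂ : X → EReal} (h : g₁ =ᵐ[ν] g₂) :
    eintegral ν g₁ = eintegral ν g₂ := by
  have hpos := lintegral_congr_ae (h.fun_comp EReal.toENNReal)
  have hneg := lintegral_congr_ae (h.fun_comp fun y => (-y).toENNReal)
  simp only [Function.comp_apply] at hpos hneg
  simp only [eintegral, hpos, hneg]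

lemma eintegral_coe {u : X → ℝ} (hu : Integrable u ν) :
    eintegral ν (fun x => (u x : EReal)) = ((∫ x, u x ∂ν : ℝ) : EReal) := by
  rw [integral_eq_lintegral_pos_part_sub_lintegral_neg_part hu, eintegral, EReal.coe_sub]
  simp only [EReal.real_coe_toENNReal, ← EReal.coe_neg]
  congr 1
  exacts [(EReal.coe_ennreal_toReal hu.lintegral_lt_top.ne).symm,
    (EReal.coe_ennreal_toReal hu.neg.lintegral_lt_top.ne).symm]

lemma eintegral_coe_add_coe_ennreal {u : X → ℝ} {k : X → ℝ≥0∞} (hu : Integrable u ν)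
    (hk : AEMeasurable k ν) :
    eintegral ν (fun x => (u x : EReal) + k x)
      = ((∫ x, u x ∂ν : ℝ) : EReal) + ((∫⁻ x, k x ∂ν : ℝ≥0∞) : EReal) := by
  rcases eq_or_ne (∫⁻ x, k x ∂ν) ⊤ with htop | hfin
  · -- The negative part is controlled by that of `u`, so the positive part diverges.
    have hneg : ∫⁻ x, ENNReal.ofReal (-u x) ∂ν < ⊤ := hu.neg.lintegral_lt_top
    have hmeas : AEMeasurable (fun x => ENNReal.ofReal (-u x)) ν :=
      hu.neg.aemeasurable.ennreal_ofReal
    have hle (x : X) : k x ≤ ((u x : EReal) + k x).toENNReal + ENNReal.ofReal (-u x) :=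
      calc k x = ((u x : EReal) + k x + (-u x : ℝ)).toENNReal := by
            rw [EReal.coe_neg, ← sub_eq_add_neg, EReal.add_sub_cancel_left, EReal.toENNReal_coe]
        _ ≤ _ := EReal.toENNReal_add_le
    have hle' := lintegral_mono (μ := ν) hle
    rw [htop, lintegral_add_right' _ hmeas, top_le_iff,
      ENNReal.add_eq_top, or_iff_left hneg.ne] at hle'
    have hneg' : ∫⁻ x, (-((u x : EReal) + k x)).toENNReal ∂ν ≠ ⊤ :=
      ne_top_of_le_ne_top hneg.ne (lintegral_mono fun x => by
        rw [← EReal.real_coe_toENNReal, EReal.coe_neg]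
        exact EReal.toENNReal_le_toENNReal (EReal.neg_le_neg_iff.2
          (le_add_of_nonneg_right (EReal.coe_ennreal_nonneg _))))
    rw [eintegral, hle', htop, EReal.coe_ennreal_top, EReal.coe_add_top,
      ← EReal.coe_ennreal_toReal hneg', EReal.top_sub_coe]
  · have hint : Integrable (fun x => (k x).toReal) ν :=
      integrable_toReal_of_lintegral_ne_top hk hfin
    have hae : (fun x => (u x : EReal) + k x) =ᵐ[ν]
        fun x => ((u x + (k x).toReal : ℝ) : EReal) := by
      filter_upwards [ae_lt_top' hk hfin] with x hx
      rw [EReal.coe_add, EReal.coe_ennreal_toReal hx.ne]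
    rw [eintegral_congr_ae hae, eintegral_coe (u := fun x => u x + (k x).toReal) (hu.add hint),
      integral_add hu hint, EReal.coe_add, integral_toReal hk (ae_lt_top' hk hfin),
      EReal.coe_ennreal_toReal hfin]

lemma coe_add_toENNReal_sub {a : ℝ} {b : EReal} (h : (a : EReal) ≤ b) :
    (a : EReal) + (b - a).toENNReal = b := by
  rw [EReal.coe_toENNReal (EReal.sub_nonneg (by simp) (by simp) |>.2 h), add_comm,
    EReal.sub_add_cancel]

lemma eintegral_add {g h : X → EReal} {u v : X → ℝ} (hg : Measurable g) (hh : Measurable h)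
    (hu : Integrable u ν) (hv : Integrable v ν) (hug : ∀ x, (u x : EReal) ≤ g x)
    (hvh : ∀ x, (v x : EReal) ≤ h x) :
    eintegral ν (fun x => g x + h x) = eintegral ν g + eintegral ν h := by
  have hk : AEMeasurable (fun x => (g x - u x).toENNReal) ν :=
    (hg.aemeasurable.sub hu.aemeasurable.coe_real_ereal).ereal_toENNReal
  have hl : AEMeasurable (fun x => (h x - v x).toENNReal) ν :=
    (hh.aemeasurable.sub hv.aemeasurable.coe_real_ereal).ereal_toENNReal
  generalize hkg : (fun x => (g x - u x).toENNReal) = k at hk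
  generalize hlh : (fun x => (h x - v x).toENNReal) = l at hl
  obtain rfl : (fun x => (u x : EReal) + k x) = g :=
    funext fun x => hkg ▸ coe_add_toENNReal_sub (hug x)
  obtain rfl : (fun x => (v x : EReal) + l x) = h :=
    funext fun x => hlh ▸ coe_add_toENNReal_sub (hvh x)
  have hsum (x : X) : (u x : EReal) + k x + (v x + l x)
      = ((u x + v x : ℝ) : EReal) + ((k x + l x : ℝ≥0∞) : EReal) := by
    rw [EReal.coe_add, EReal.coe_ennreal_add, add_add_add_comm]
  simp only [hsum]
  rw [eintegral_coe_add_coe_ennreal (u := fun x => u x + v x) (k := fun x => k x + l x)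
      (hu.add hv) (hk.add hl),
    eintegral_coe_add_coe_ennreal hu hk, eintegral_coe_add_coe_ennreal hv hl,
    lintegral_add_left' hk, integral_add hu hv, EReal.coe_add, EReal.coe_ennreal_add,
    add_add_add_comm]

lemma coe_add_coe_iSup (a : ℝ) (k : ℕ → ℝ≥0∞) :
    (a : EReal) + ((⨆ n, k n : ℝ≥0∞) : EReal) = ⨆ n, (a : EReal) + k n := by
  have hmono : Monotone fun t : ℝ≥0∞ => (a : EReal) + t := fun s t hst =>
    add_le_add le_rfl (EReal.coe_ennreal_le_coe_ennreal_iff.2 hst)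
  have hcont : Continuous fun t : ℝ≥0∞ => (a : EReal) + t :=
    continuous_iff_continuousAt.2 fun t =>
      (EReal.continuousAt_add (p := ((a : EReal), (t : EReal))) (by simp) (by simp)).comp
        (f := fun t : ℝ≥0∞ => ((a : EReal), (t : EReal)))
        (continuous_const.prodMk continuous_coe_ennreal_ereal).continuousAt
  exact hmono.map_ciSup_of_continuousAt hcont.continuousAt

lemma eintegral_iSup_of_monotone {F : ℕ → X → ℝ} (hF : ∀ n, Integrable (F n) ν)
    (hmono : Monotone F) :
    eintegral ν (fun x => ⨆ n, (F n x : EReal)) = ⨆ n, ((∫ x, F n x ∂ν : ℝ) : EReal) := by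
  have hsplit (n : ℕ) (x : X) :
      (F n x : EReal) = F 0 x + ((ENNReal.ofReal (F n x - F 0 x) : ℝ≥0∞) : EReal) := by
    rw [EReal.coe_ennreal_ofReal, max_eq_left (sub_nonneg.2 (hmono n.zero_le x)),
      ← EReal.coe_add, add_sub_cancel]
  have hmeas (n : ℕ) : AEMeasurable (fun x => ENNReal.ofReal (F n x - F 0 x)) ν :=
    ((hF n).sub (hF 0)).aemeasurable.ennreal_ofReal
  have hint (n : ℕ) : ((∫ x, F n x ∂ν : ℝ) : EReal) = ((∫ x, F 0 x ∂ν : ℝ) : EReal)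
      + ((∫⁻ x, ENNReal.ofReal (F n x - F 0 x) ∂ν : ℝ≥0∞) : EReal) := by
    rw [← eintegral_coe_add_coe_ennreal (hF 0) (hmeas n), ← eintegral_coe (hF n)]
    simp only [← hsplit n]
  have hsup (x : X) : ⨆ n, (F n x : EReal)
      = F 0 x + ((⨆ n, ENNReal.ofReal (F n x - F 0 x) : ℝ≥0∞) : EReal) := by
    rw [coe_add_coe_iSup]
    exact iSup_congr fun n => hsplit n x
  rw [funext hsup, iSup_congr hint, eintegral_coe_add_coe_ennreal (hF 0) (.iSup hmeas),
    lintegral_iSup' hmeas (.of_forall fun x m n hmn =>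
      ENNReal.ofReal_le_ofReal (sub_le_sub_right (hmono hmn x) _)),
    coe_add_coe_iSup]

end Integral

section Selection

variable {X : Type*} [MeasurableSpace X] {ν : Measure X}

lemma exists_simpleFunc_argmax {α : Type*} [LinearOrder α] [TopologicalSpace α]
    [OrderClosedTopology α] [SecondCountableTopology α] [MeasurableSpace α] [OpensMeasurableSpace α]
    {v : ℕ → X → α} (hv : ∀ k, Measurable (v k)) (n : ℕ) :
    ∃ i : SimpleFunc X ℕ, (∀ x, i x ≤ n) ∧ ∀ x, ∀ j ≤ n, v j x ≤ v (i x) x := by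
  classical
  let i (x : X) : ℕ := Nat.findGreatest (fun k => ∀ j ≤ n, v j x ≤ v k x) n
  have hi : Measurable i := measurable_findGreatest fun k _ => by
    rw [measurableSet_setOfPred]
    exact .forall fun j => .forall fun _ =>
      measurableSet_setOfPred.1 (measurableSet_le (hv j) (hv k))
  have hle (x : X) : i x ≤ n := Nat.findGreatest_le n
  refine ⟨⟨i, fun k => hi (measurableSet_singleton k), (Set.finite_Iic n).subset
    (Set.range_subset_iff.2 hle)⟩, hle, fun x => ?_⟩
  obtain ⟨k, hk, hmax⟩ := (Finset.Iic n).exists_max_image (v · x) ⟨n, by simp⟩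
  exact Nat.findGreatest_spec (P := fun k => ∀ j ≤ n, v j x ≤ v k x) (by simpa using hk)
    fun j hj => hmax j (by simpa using hj)

lemma integrable_simpleFunc_eval {G : Type*} {F : X → G → ℝ}
    (hF : ∀ g, Integrable (fun x => F x g) ν) (w : SimpleFunc X G) :
    Integrable (fun x => F x (w x)) ν := by
  classical
  have h : (fun x => F x (w x)) =
      fun x => ∑ g ∈ w.range, (w ⁻¹' {g}).indicator (fun x => F x g) x := by
    funext x
    rw [Finset.sum_eq_single_of_mem (w x) (w.mem_range_self x)]
    · simp
    · exact fun g _ hg => Set.indicator_of_notMem (fun h => hg (Eq.symm h)) _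
  rw [h]
  exact integrable_finsetSum _ fun g _ => (hF g).indicator (w.measurableSet_fiber g)

theorem exists_simpleFunc_lt_integral {G : Type*} [TopologicalSpace G]
    [TopologicalSpace.SeparableSpace G] [Nonempty G] {F : X → G → ℝ}
    (hmeas : ∀ g, Measurable fun x => F x g) (hint : ∀ g, Integrable (fun x => F x g) ν)
    (hcont : ∀ x, Continuous (F x)) {M : ℝ}
    (hM : (M : EReal) < eintegral ν (fun x => ⨆ g, (F x g : EReal))) :
    ∃ w : SimpleFunc X G, M < ∫ x, F x (w x) ∂ν := by
  let u : ℕ → G := TopologicalSpace.denseSeq G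
  choose i hin hmax using fun n => exists_simpleFunc_argmax (fun k => hmeas (u k)) n
  have hmono : Monotone fun (n : ℕ) (x : X) => F x (u (i n x)) :=
    fun m n hmn x => hmax n x _ ((hin m x).trans hmn)
  have hsup (x : X) : ⨆ g, (F x g : EReal) = ⨆ n, (F x (u (i n x)) : EReal) := by
    refine le_antisymm ?_ (iSup_le fun n => le_iSup (fun g => (F x g : EReal)) _)
    rw [← Dense.ciSup' (f := fun g => (F x g : EReal)) (TopologicalSpace.denseRange_denseSeq G)
      (continuous_coe_real_ereal.comp (hcont x)), iSup_le_iff, Subtype.forall]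
    rintro _ ⟨n, rfl⟩
    exact (EReal.coe_le_coe_iff.2 (hmax n x n le_rfl)).trans
      (le_iSup (fun n => (F x (u (i n x)) : EReal)) n)
  have hintF (n : ℕ) : Integrable (fun x => F x (u (i n x))) ν :=
    integrable_simpleFunc_eval hint ((i n).map u)
  rw [funext hsup, eintegral_iSup_of_monotone hintF hmono, lt_iSup_iff] at hM
  obtain ⟨n, hn⟩ := hM
  exact ⟨(i n).map u, EReal.coe_lt_coe_iff.1 hn⟩

end Selection

section VariationalFormula

variable {X : Type*} [MeasurableSpace X] {φ : ℝ → EReal} {ξ ν : Measure X} {g h : X → ℝ} {a b : ℝ}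

lemma integrable_of_mem_Icc [IsFiniteMeasure ν] (hg : Measurable g)
    (hab : ∀ x, g x ∈ Set.Icc a b) : Integrable g ν :=
  .of_mem_Icc a b hg.aemeasurable (.of_forall hab)

lemma integrable_toReal_rnDeriv_mul [SigmaFinite ξ] [SigmaFinite ν] (hh : Integrable h ξ) :
    Integrable (fun x => (ξ.rnDeriv ν x).toReal * h x) ν :=
  (integrable_withDensity_iff_integrable_smul' (ξ.measurable_rnDeriv ν) (ξ.rnDeriv_lt_top ν)).1
    (hh.mono_measure (ξ.withDensity_rnDeriv_le ν))

lemma integral_eq_singularPart_add [SigmaFinite ξ] [SigmaFinite ν] (hh : Integrable h ξ) :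
    ∫ x, h x ∂ξ = ∫ x, h x ∂(ξ.singularPart ν) + ∫ x, (ξ.rnDeriv ν x).toReal * h x ∂ν := by
  conv_lhs => rw [ξ.haveLebesgueDecomposition_add ν]
  rw [integral_add_measure (hh.mono_measure (ξ.singularPart_le ν))
      (hh.mono_measure (ξ.withDensity_rnDeriv_le ν)),
    integral_withDensity_eq_integral_toReal_smul (ξ.measurable_rnDeriv ν) (ξ.rnDeriv_lt_top ν)]
  rfl

lemma coe_integral_le_mul_measure_univ [IsFiniteMeasure ξ] (hh : Integrable h ξ) {s : EReal}
    (hs : ∀ x, (h x : EReal) ≤ s) :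
    ((∫ x, h x ∂ξ : ℝ) : EReal) ≤ s * ((ξ Set.univ : ℝ≥0∞) : EReal) := by
  rcases eq_or_ne ξ 0 with rfl | hξ
  · simp
  obtain ⟨x⟩ : Nonempty X := by
    by_contra! hX
    exact hξ (Measure.eq_zero_of_isEmpty ξ)
  have hpos : 0 < ξ.real Set.univ := by
    have : NeZero ξ := ⟨hξ⟩
    exact measureReal_univ_pos
  rw [← EReal.coe_ennreal_toReal (measure_ne_top ξ Set.univ)]
  induction s with
  | bot => exact absurd (hs x) (EReal.bot_lt_coe _).not_ge
  | top => exact le_top.trans_eq (EReal.top_mul_coe_of_pos hpos).symm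
  | coe s =>
    have hle := integral_mono hh (integrable_const s) fun x => EReal.coe_le_coe_iff.1 (hs x)
    rw [integral_const, smul_eq_mul, mul_comm] at hle
    exact_mod_cast hle

/-- The test functions of the variational formula for `fDiv`: bounded measurable functions whose
values stay away from `φ'(∞)`, so that `conjugate φ ∘ g` is bounded too. -/
structure IsAdmissible (φ : ℝ → EReal) (g : X → ℝ) : Prop where
  measurable : Measurable g
  exists_bounds : ∃ a b : ℝ, (b : EReal) < slopeAtTop φ ∧ ∀ x, g x ∈ Set.Icc a b

lemma IsAdmissible.lt_slopeAtTop (hg : IsAdmissible φ g) (x : X) :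
    (g x : EReal) < slopeAtTop φ := by
  obtain ⟨a, b, hb, hab⟩ := hg.exists_bounds
  exact (EReal.coe_le_coe_iff.2 (hab x).2).trans_lt hb

lemma IsAdmissible.integrable [IsFiniteMeasure ξ] (hg : IsAdmissible φ g) : Integrable g ξ := by
  obtain ⟨a, b, -, hab⟩ := hg.exists_bounds
  exact integrable_of_mem_Icc hg.measurable hab

lemma coe_mul_le_conjugate_add {x : ℝ} (hφ : φ x ≠ ⊥) {y : ℝ} (hy : conjugate φ y ≠ ⊥) :
    ((x * y : ℝ) : EReal) ≤ conjugate φ y + φ x :=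
  (EReal.sub_le_iff_le_add (.inl hφ) (.inr hy)).1
    (le_iSup (fun x : ℝ => ((x * y : ℝ) : EReal) - φ x) x)

namespace IsEntropy

variable (hφ : IsEntropy φ)
include hφ

lemma isAdmissible_simpleFunc (g : SimpleFunc X ℝ) (hg : ∀ x, (g x : EReal) < slopeAtTop φ) :
    IsAdmissible φ g := by
  obtain ⟨y, hy⟩ := hφ.exists_lt_slopeAtTop
  let T : Finset ℝ := insert y g.range
  have hT : T.Nonempty := Finset.insert_nonempty y _
  have hgT (x : X) : g x ∈ T := Finset.mem_insert_of_mem (g.mem_range_self x)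
  refine ⟨g.measurable, T.min' hT, T.max' hT, ?_, fun x => ⟨T.min'_le _ (hgT x),
    T.le_max' _ (hgT x)⟩⟩
  rcases Finset.mem_insert.1 (T.max'_mem hT) with h | h
  · exact h ▸ hy
  · obtain ⟨x, hx⟩ := SimpleFunc.mem_range.1 h
    exact hx ▸ hg x

lemma integrable_toReal_conjugate [IsFiniteMeasure ν] (hg : IsAdmissible φ g) :
    Integrable (fun x => (conjugate φ (g x)).toReal) ν := by
  obtain ⟨a, b, hb, hab⟩ := hg.exists_bounds
  exact integrable_of_mem_Icc
    (measurable_ereal_toReal.comp (hφ.monotone_conjugate.measurable.comp hg.measurable))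
    fun x => hφ.toReal_conjugate_mem_Icc hb (hab x)

lemma eintegral_conjugate [IsFiniteMeasure ν] (hg : IsAdmissible φ g) :
    eintegral ν (fun x => conjugate φ (g x))
      = ((∫ x, (conjugate φ (g x)).toReal ∂ν : ℝ) : EReal) := by
  rw [← eintegral_coe (hφ.integrable_toReal_conjugate hg)]
  simp only [hφ.coe_toReal_conjugate (hg.lt_slopeAtTop _)]

theorem coe_integral_le_eintegral_conjugate_add_fDiv [IsFiniteMeasure ξ] [IsFiniteMeasure ν]
    (hh : Measurable h) (hab : ∀ x, h x ∈ Set.Icc a b)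
    (hs : ∀ x, (h x : EReal) ≤ slopeAtTop φ) :
    ((∫ x, h x ∂ξ : ℝ) : EReal) ≤ eintegral ν (fun x => conjugate φ (h x)) + fDiv φ ξ ν := by
  obtain ⟨p, hp⟩ := hφ.exists_mem_epi
  obtain ⟨q, hq⟩ := hφ.exists_mem_epi_conjugate
  have hφρ : Measurable fun x => φ (ξ.rnDeriv ν x).toReal :=
    hφ.lsc.measurable.comp (ξ.measurable_rnDeriv ν).ennreal_toReal
  have hconj : Measurable fun x => conjugate φ (h x) :=
    hφ.monotone_conjugate.measurable.comp hh
  have hhξ : Integrable h ξ := integrable_of_mem_Icc hh hab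
  have hhν : Integrable h ν := integrable_of_mem_Icc hh hab
  have hyoung (x : X) : (((ξ.rnDeriv ν x).toReal * h x : ℝ) : EReal)
      ≤ conjugate φ (h x) + φ (ξ.rnDeriv ν x).toReal :=
    coe_mul_le_conjugate_add (hφ.proper.2 _).ne' (hφ.bot_lt_conjugate _).ne'
  rw [fDiv, ← add_assoc, integral_eq_singularPart_add (ν := ν) hhξ, EReal.coe_add, add_comm]
  refine add_le_add ?_
    (coe_integral_le_mul_measure_univ (hhξ.mono_measure (ξ.singularPart_le ν)) hs)
  rw [← eintegral_coe (integrable_toReal_rnDeriv_mul hhξ),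
    ← eintegral_add hconj hφρ ((hhν.mul_const p.1).sub (integrable_const p.2))
      ((Measure.integrable_toReal_rnDeriv.mul_const q.1).sub (integrable_const q.2))
      (fun x => mul_sub_le_conjugate hp (h x))
      fun x => (mul_sub_le_conjugate hq _).trans (conjugate_conjugate_le φ _)]
  exact eintegral_mono hyoung

end IsEntropy

lemma exists_coe_lt_lt_add {u v : EReal} {M : ℝ} (h : (M : EReal) < u + v) :
    ∃ m t : ℝ, (m : EReal) < u ∧ (t : EReal) < v ∧ M < m + t := by
  by_contra! hcon
  refine h.not_ge (EReal.add_le_of_forall_lt fun m hm t ht => ?_)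
  induction m with
  | bot => simp
  | top => exact absurd hm not_top_lt
  | coe m =>
    induction t with
    | bot => simp
    | top => exact absurd ht not_top_lt
    | coe t => exact_mod_cast hcon m t hm ht

namespace IsEntropy

variable (hφ : IsEntropy φ)
include hφ

lemma exists_lt_slopeAtTop_le_mul {σ t : ℝ} (hσ : 0 ≤ σ) (ht : (t : EReal) < slopeAtTop φ * σ) :
    ∃ β : ℝ, (β : EReal) < slopeAtTop φ ∧ t ≤ β * σ := by
  rcases hσ.eq_or_lt with rfl | hσ
  · obtain ⟨β, hβ⟩ := hφ.exists_lt_slopeAtTop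
    exact ⟨β, hβ, by simpa using ht.le⟩
  · refine ⟨t / σ, ?_, (div_mul_cancel₀ t hσ.ne').ge⟩
    by_contra! hle
    have hmul := mul_le_mul_of_nonneg_right hle (EReal.coe_nonneg.2 hσ.le)
    rw [← EReal.coe_mul, div_mul_cancel₀ t hσ.ne'] at hmul
    exact ht.not_ge hmul

lemma exists_simpleFunc_lt_of_lt_eintegral [IsFiniteMeasure ν] [IsFiniteMeasure ξ] {m : ℝ}
    (hm : (m : EReal) < eintegral ν fun x => φ (ξ.rnDeriv ν x).toReal) :
    ∃ w : SimpleFunc X ℝ, (∀ x, (w x : EReal) < slopeAtTop φ) ∧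
      m < ∫ x, (ξ.rnDeriv ν x).toReal * w x ∂ν - ∫ x, (conjugate φ (w x)).toReal ∂ν := by
  have : Nonempty (dualEpi φ) := by
    obtain ⟨y, hy⟩ := hφ.exists_lt_slopeAtTop
    exact ⟨(y, (conjugate φ y).toReal), hy, (hφ.coe_toReal_conjugate hy).ge⟩
  have hρ : Measurable fun x => (ξ.rnDeriv ν x).toReal := (ξ.measurable_rnDeriv ν).ennreal_toReal
  simp only [hφ.eq_iSup_dualEpi] at hm
  obtain ⟨w, hw⟩ := exists_simpleFunc_lt_integral
    (F := fun x (q : dualEpi φ) => (ξ.rnDeriv ν x).toReal * q.1.1 - q.1.2)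
    (fun q => (hρ.mul_const _).sub_const _)
    (fun q => (Measure.integrable_toReal_rnDeriv.mul_const _).sub (integrable_const _))
    (fun x => by fun_prop) hm
  refine ⟨w.map fun q => q.1.1, fun x => (w x).2.1, hw.trans_le ?_⟩
  have hadm := hφ.isAdmissible_simpleFunc (w.map fun q => q.1.1) fun x => (w x).2.1
  have hint := integrable_toReal_rnDeriv_mul (ν := ν) (hadm.integrable (ξ := ξ))
  have hconj := hφ.integrable_toReal_conjugate (ν := ν) hadm
  rw [← integral_sub hint hconj]
  refine integral_mono (integrable_simpleFunc_eval (fun q : dualEpi φ =>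
    (Measure.integrable_toReal_rnDeriv.mul_const q.1.1).sub (integrable_const q.1.2)) w)
    (hint.sub hconj) fun x => sub_le_sub_left ?_ _
  exact EReal.coe_le_coe_iff.1 ((hφ.coe_toReal_conjugate (w x).2.1).trans_le (w x).2.2)

theorem exists_isAdmissible_lt_of_lt_fDiv [IsFiniteMeasure ξ] [IsFiniteMeasure ν] {M : ℝ}
    (hM : (M : EReal) < fDiv φ ξ ν) :
    ∃ g : X → ℝ, IsAdmissible φ g ∧
      M < ∫ x, g x ∂ξ - ∫ x, (conjugate φ (g x)).toReal ∂ν := by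
  rw [fDiv, ← EReal.coe_ennreal_toReal (measure_ne_top _ _)] at hM
  obtain ⟨m, t, hm, ht, hmt⟩ := exists_coe_lt_lt_add hM
  obtain ⟨β, hβ, htβ⟩ := hφ.exists_lt_slopeAtTop_le_mul ENNReal.toReal_nonneg ht
  obtain ⟨w, hwlt, hw⟩ := hφ.exists_simpleFunc_lt_of_lt_eintegral hm
  obtain ⟨S, hS, hsing, hν⟩ := ξ.mutuallySingular_singularPart ν
  classical
  let g : SimpleFunc X ℝ := w.piecewise S hS (.const X β)
  have hg : IsAdmissible φ g := hφ.isAdmissible_simpleFunc g fun x => by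
    by_cases hx : x ∈ S
    · simpa [g, hx] using hwlt x
    · simpa [g, hx] using hβ
  have hgν : ∀ᵐ x ∂ν, g x = w x := by
    filter_upwards [show ∀ᵐ x ∂ν, x ∈ S from hν] with x hx
    simp [g, hx]
  have hgsing : ∀ᵐ x ∂(ξ.singularPart ν), g x = β := by
    filter_upwards [show ∀ᵐ x ∂(ξ.singularPart ν), x ∉ S from measure_eq_zero_iff_ae_notMem.1 hsing]
      with x hx
    simp [g, hx]
  refine ⟨g, hg, ?_⟩
  rw [integral_eq_singularPart_add (ν := ν) hg.integrable, integral_congr_ae hgsing,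
    integral_congr_ae (hgν.mono fun x hx => congrArg ((ξ.rnDeriv ν x).toReal * ·) hx),
    integral_congr_ae (hgν.mono fun x hx => congrArg (fun y => (conjugate φ y).toReal) hx),
    integral_const, smul_eq_mul, mul_comm]
  have : t ≤ β * (ξ.singularPart ν).real Set.univ := htβ
  linarith

theorem fDiv_le_coe_iff [IsFiniteMeasure ξ] [IsFiniteMeasure ν] {v : ℝ} :
    fDiv φ ξ ν ≤ v ↔ ∀ g : X → ℝ, IsAdmissible φ g →
      ∫ x, g x ∂ξ ≤ v + ∫ x, (conjugate φ (g x)).toReal ∂ν := by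
  refine ⟨fun h g hg => ?_, fun h => ?_⟩
  · obtain ⟨a, b, -, hab⟩ := hg.exists_bounds
    have hweak := hφ.coe_integral_le_eintegral_conjugate_add_fDiv (ξ := ξ) (ν := ν) hg.measurable
      hab fun x => (hg.lt_slopeAtTop x).le
    rw [hφ.eintegral_conjugate hg] at hweak
    rw [add_comm]
    exact_mod_cast hweak.trans (add_le_add le_rfl h)
  · by_contra! hlt
    obtain ⟨g, hg, hgv⟩ := hφ.exists_isAdmissible_lt_of_lt_fDiv hlt
    linarith [h g hg]

end IsEntropy

end VariationalFormula

section Competitors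

variable {X : Type*} [MeasurableSpace X] {φ : ℝ → EReal} {ξ η ν : Measure X}
  {f g ρ c : X → ℝ} {a b r s v : ℝ}

lemma integral_withDensity_ofReal (hρ : Measurable ρ) (h₀ : ∀ x, 0 ≤ ρ x) (g : X → ℝ) :
    ∫ x, g x ∂(ν.withDensity fun x => ENNReal.ofReal (ρ x)) = ∫ x, ρ x * g x ∂ν := by
  rw [integral_withDensity_eq_integral_toReal_smul hρ.ennreal_ofReal
    (.of_forall fun _ => ENNReal.ofReal_lt_top)]
  simp only [ENNReal.toReal_ofReal (h₀ _), smul_eq_mul]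

namespace IsEntropy

variable (hφ : IsEntropy φ)
include hφ

lemma fDiv_combo_le [IsFiniteMeasure ξ] [IsFiniteMeasure η] [IsFiniteMeasure ν] {u : ℝ}
    (hξ : fDiv φ ξ ν ≤ u) (hη : fDiv φ η ν ≤ v) {α β : ℝ≥0} (hαβ : α + β = 1) :
    fDiv φ (α • ξ + β • η) ν ≤ (α * u + β * v : ℝ) := by
  rw [hφ.fDiv_le_coe_iff] at hξ hη ⊢
  intro g hg
  rw [integral_add_measure hg.integrable hg.integrable, integral_smul_nnreal_measure,
    integral_smul_nnreal_measure, NNReal.smul_def, NNReal.smul_def, smul_eq_mul, smul_eq_mul]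
  have hαβ : (α + β : ℝ) = 1 := mod_cast hαβ
  linear_combination mul_le_mul_of_nonneg_left (hξ g hg) α.coe_nonneg
    + mul_le_mul_of_nonneg_left (hη g hg) β.coe_nonneg
    + (∫ x, (conjugate φ (g x)).toReal ∂ν) * hαβ

lemma fDiv_withDensity_le [IsFiniteMeasure ν] (hρm : Measurable ρ) (hρ : Integrable ρ ν)
    (hc : Integrable c ν) (hepi : ∀ x, (ρ x, c x) ∈ epi φ) :
    fDiv φ (ν.withDensity fun x => ENNReal.ofReal (ρ x)) ν ≤ (∫ x, c x ∂ν : ℝ) := by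
  have := isFiniteMeasure_withDensity_ofReal hρ.2
  refine hφ.fDiv_le_coe_iff.2 fun g hg => ?_
  obtain ⟨a, b, -, hab⟩ := hg.exists_bounds
  have hρg : Integrable (fun x => ρ x * g x) ν :=
    hρ.mul_bdd hg.measurable.aestronglyMeasurable
      (.of_forall fun x => abs_le_max_abs_abs (hab x).1 (hab x).2)
  have hconj := hφ.integrable_toReal_conjugate (ν := ν) hg
  rw [integral_withDensity_ofReal hρm (fun x => hφ.nonneg_of_mem_epi (hepi x)),
    ← integral_add hc hconj]
  refine integral_mono hρg (hc.add hconj) fun x => ?_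
  have hyoung := (hφ.toReal_conjugate_le_iff (hg.lt_slopeAtTop x)).1 le_rfl _ (hepi x)
  simp only at hyoung ⊢
  linarith

lemma fDiv_add_le [IsFiniteMeasure ξ] [IsFiniteMeasure η] [IsFiniteMeasure ν]
    (hξ : fDiv φ ξ ν ≤ v) (hs : slopeAtTop φ ≤ s) :
    fDiv φ (ξ + η) ν ≤ (v + η.real Set.univ * s : ℝ) := by
  rw [hφ.fDiv_le_coe_iff] at hξ ⊢
  intro g hg
  have hgs (x : X) : g x ≤ s := EReal.coe_le_coe_iff.1 ((hg.lt_slopeAtTop x).le.trans hs)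
  have hη : ∫ x, g x ∂η ≤ η.real Set.univ * s := by
    simpa using integral_mono hg.integrable (integrable_const s) hgs
  rw [integral_add_measure hg.integrable hg.integrable]
  linarith [hξ g hg]

lemma measureReal_univ_eq_of_effDom_subset [IsFiniteMeasure ξ] [IsFiniteMeasure ν]
    (ha : effDom φ ⊆ {a}) (hv : fDiv φ ξ ν ≤ v) :
    ξ.real Set.univ = a * ν.real Set.univ := by
  obtain ⟨c, hc⟩ : ∃ c : ℝ, φ a = c := by
    obtain ⟨x, hx⟩ := hφ.proper.1
    obtain rfl : x = a := ha hx
    exact ⟨_, (EReal.coe_toReal hx.ne (hφ.proper.2 x).ne').symm⟩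
  have hconj (y : ℝ) : conjugate φ y ≤ (y * a - c : ℝ) := conjugate_le_iff.2 fun p hp => by
    obtain hpa : p.1 = a := ha (mem_effDom_of_le_coe hp)
    rw [mem_epi, hpa, hc] at hp
    rw [hpa]
    exact_mod_cast sub_le_sub_left (EReal.coe_le_coe_iff.1 hp) _
  have hlt (y : ℝ) : (y : EReal) < slopeAtTop φ :=
    (EReal.coe_lt_coe_iff.2 (lt_add_one y)).trans_le
      (hφ.le_slopeAtTop (mem_effDom_of_le_coe (hconj (y + 1))))
  have hline (y : ℝ) : y * (ξ.real Set.univ - a * ν.real Set.univ) ≤ v - c * ν.real Set.univ := by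
    have hy := hφ.fDiv_le_coe_iff.1 hv (fun _ => y) ⟨measurable_const, y, y, hlt y, by simp⟩
    have hle := mul_le_mul_of_nonneg_left
      (EReal.coe_le_coe_iff.1 ((hφ.coe_toReal_conjugate (hlt y)).trans_le (hconj y)))
      (measureReal_nonneg (μ := ν) (s := Set.univ))
    simp only [integral_const, smul_eq_mul] at hy
    linarith
  by_contra! hne
  have habs := hline ((v - c * ν.real Set.univ + 1) / (ξ.real Set.univ - a * ν.real Set.univ))
  rw [div_mul_cancel₀ _ (sub_ne_zero.2 hne)] at habs
  linarith

end IsEntropy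

/-- The pairs `(m, v)` such that a measure `ξ` of total mass `m` attains at least the value `v` in
the maximisation of `∫ f dξ - fDiv φ ξ ν`. Its fibre over `m = 1` describes `tightConj φ ν f`. -/
def payoffSet (φ : ℝ → EReal) (ν : Measure X) (f : X → ℝ) : Set (ℝ × ℝ) :=
  {q | ∃ ξ : Measure X, IsFiniteMeasure ξ ∧ ξ.real Set.univ = q.1 ∧
    fDiv φ ξ ν ≤ (∫ x, f x ∂ξ - q.2 : ℝ)}

lemma le_tightConj_of_mem_payoffSet {q : ℝ × ℝ} (hq : q ∈ payoffSet φ ν f) (h₁ : q.1 = 1) :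
    (q.2 : EReal) ≤ tightConj φ ν f := by
  obtain ⟨ξ, hfin, hmass, hξ⟩ := hq
  have hprob : IsProbabilityMeasure ξ := ⟨by
    rw [← ENNReal.ofReal_toReal (measure_ne_top ξ Set.univ), ← measureReal_def, hmass, h₁,
      ENNReal.ofReal_one]⟩
  calc (q.2 : EReal) = (∫ x, f x ∂ξ : ℝ) - (∫ x, f x ∂ξ - q.2 : ℝ) := by
        rw [← EReal.coe_sub, sub_sub_cancel]
    _ ≤ (∫ x, f x ∂ξ : ℝ) - fDiv φ ξ ν := EReal.sub_le_sub le_rfl hξ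
    _ ≤ tightConj φ ν f := le_iSup (fun ξ : ProbabilityMeasure X =>
        ((∫ x, f x ∂(ξ : Measure X) : ℝ) : EReal) - fDiv φ ξ ν) ⟨ξ, hprob⟩

namespace IsEntropy

variable (hφ : IsEntropy φ)
include hφ

lemma convex_payoffSet [IsFiniteMeasure ν] (hf : Measurable f)
    (hab : ∀ x, f x ∈ Set.Icc a b) : Convex ℝ (payoffSet φ ν f) := by
  rintro p ⟨ξ, hξ, hp, hpv⟩ q ⟨η, hη, hq, hqv⟩ α β hα hβ hαβ
  lift α to ℝ≥0 using hα
  lift β to ℝ≥0 using hβ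
  refine ⟨α • ξ + β • η, inferInstance, ?_, (hφ.fDiv_combo_le hpv hqv (mod_cast hαβ)).trans_eq ?_⟩
  · rw [measureReal_add_apply, measureReal_nnreal_smul_apply, measureReal_nnreal_smul_apply, hp, hq]
    rfl
  · rw [integral_add_measure (integrable_of_mem_Icc hf hab) (integrable_of_mem_Icc hf hab),
      integral_smul_nnreal_measure, integral_smul_nnreal_measure]
    simp only [NNReal.smul_def, smul_eq_mul, Prod.snd_add, Prod.smul_snd]
    congr 1
    ring

lemma withDensity_mem_payoffSet [IsFiniteMeasure ν] (hρm : Measurable ρ) (hρ : Integrable ρ ν)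
    (hc : Integrable c ν) (hepi : ∀ x, (ρ x, c x) ∈ epi φ) :
    (∫ x, ρ x ∂ν, ∫ x, ρ x * f x ∂ν - ∫ x, c x ∂ν) ∈ payoffSet φ ν f := by
  have hint := integral_withDensity_ofReal (ν := ν) hρm fun x => hφ.nonneg_of_mem_epi (hepi x)
  refine ⟨_, isFiniteMeasure_withDensity_ofReal hρ.2, ?_,
    (hφ.fDiv_withDensity_le hρm hρ hc hepi).trans_eq ?_⟩
  · simpa using hint 1
  · rw [hint, sub_sub_cancel]

lemma exists_mem_payoffSet [IsProbabilityMeasure ν] (hr : r ∈ effDom φ) :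
    ∃ q ∈ payoffSet φ ν f, q.1 = r := by
  refine ⟨_, hφ.withDensity_mem_payoffSet measurable_const (integrable_const r)
    (integrable_const (φ r).toReal) fun _ => ?_, by simp⟩
  exact (EReal.coe_toReal hr.ne (hφ.proper.2 r).ne').ge

lemma add_mem_payoffSet [IsFiniteMeasure ν] (hf : Measurable f)
    (hab : ∀ x, f x ∈ Set.Icc a b) (hs : slopeAtTop φ ≤ s) {q : ℝ × ℝ} (hq : q ∈ payoffSet φ ν f)
    {t : ℝ} (ht : 0 ≤ t) (x : X) : (q.1 + t, q.2 + t * (f x - s)) ∈ payoffSet φ ν f := by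
  obtain ⟨ξ, hξ, hmass, hv⟩ := hq
  lift t to ℝ≥0 using ht
  refine ⟨ξ + t • Measure.dirac x, inferInstance, ?_, (hφ.fDiv_add_le hv hs).trans_eq ?_⟩
  · simp [measureReal_add_apply, measureReal_nnreal_smul_apply, hmass]
  · rw [integral_add_measure (integrable_of_mem_Icc hf hab) (integrable_of_mem_Icc hf hab),
      integral_smul_nnreal_measure, integral_dirac' _ _ hf.stronglyMeasurable,
      measureReal_nnreal_smul_apply, probReal_univ, NNReal.smul_def, smul_eq_mul]
    congr 1
    ring

end IsEntropy

end Competitors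

section SupportingLine

lemma eq_singleton_or_mem_nhds_of_mem_intrinsicInterior {s : Set ℝ} {a : ℝ}
    (ha : a ∈ intrinsicInterior ℝ s) : s = {a} ∨ s ∈ nhds a := by
  have has : a ∈ s := intrinsicInterior_subset ha
  refine (Set.eq_singleton_or_nontrivial has).imp_right fun hs => ?_
  obtain ⟨z, hz, hza⟩ := hs.exists_ne a
  have htop : (affineSpan ℝ s : Set ℝ) = Set.univ := Set.eq_univ_of_forall fun x => by
    have hx := AffineMap.lineMap_mem ((x - a) / (z - a)) (subset_affineSpan ℝ s has)
      (subset_affineSpan ℝ s hz)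
    rwa [AffineMap.lineMap_apply_ring', div_mul_cancel₀ _ (sub_ne_zero.2 hza),
      sub_add_cancel] at hx
  obtain ⟨p, hp, rfl⟩ := mem_intrinsicInterior.1 ha
  have hopen : IsOpen (affineSpan ℝ s : Set ℝ) := htop ▸ isOpen_univ
  exact mem_of_superset ((hopen.isOpenMap_subtype_val _ isOpen_interior).mem_nhds ⟨p, hp, rfl⟩)
    (Set.image_subset_iff.2 interior_subset)

lemma effDom_plusPart_eq_singleton_or_mem_nhds {φ : ℝ → EReal} (hbot : ∀ x, ⊥ < φ x) {a : ℝ}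
    (ha : 0 < a) (hri : a ∈ intrinsicInterior ℝ (effDom φ)) :
    effDom (plusPart φ) = {a} ∨ effDom (plusPart φ) ∈ nhds a := by
  rw [effDom_plusPart hbot]
  refine (eq_singleton_or_mem_nhds_of_mem_intrinsicInterior hri).imp (fun h => ?_)
    fun h => inter_mem h (Ici_mem_nhds ha)
  rw [h, Set.inter_eq_left, Set.singleton_subset_iff]
  exact ha.le

variable {K : Set (ℝ × ℝ)} {m d : ℝ}

lemma div_sub_le_div_sub_of_convex (hK : Convex ℝ K) (hd : ∀ q ∈ K, q.1 = m → q.2 ≤ d)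
    {p q : ℝ × ℝ} (hp : p ∈ K) (hq : q ∈ K) (hpm : p.1 < m) (hmq : m < q.1) :
    (q.2 - d) / (q.1 - m) ≤ (d - p.2) / (m - p.1) := by
  have hpos : 0 < q.1 - p.1 := by linarith
  have hle := hd _ (hK hp hq (div_nonneg (sub_nonneg.2 hmq.le) hpos.le)
    (div_nonneg (sub_nonneg.2 hpm.le) hpos.le) (by field_simp; ring))
    (by simp only [Prod.fst_add, Prod.smul_fst, smul_eq_mul]; field_simp; ring)
  simp only [Prod.snd_add, Prod.smul_snd, smul_eq_mul, div_mul_eq_mul_div, ← add_div,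
    div_le_iff₀ hpos] at hle
  rw [div_le_div_iff₀ (sub_pos.2 hmq) (sub_pos.2 hpm)]
  linarith

lemma exists_supporting_slope (hK : Convex ℝ K) (hd : ∀ q ∈ K, q.1 = m → q.2 ≤ d)
    (hside : (∀ q ∈ K, q.1 = m) ∨ (∃ p ∈ K, p.1 < m) ∧ ∃ q ∈ K, m < q.1) :
    ∃ γ : ℝ, ∀ q ∈ K, q.2 ≤ d + γ * (q.1 - m) := by
  rcases hside with hm | ⟨⟨p₀, hp₀, hpm₀⟩, q₀, hq₀, hmq₀⟩
  · exact ⟨0, fun q hq => by simpa using hd q hq (hm q hq)⟩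
  obtain ⟨γ, hright, hleft⟩ := exists_between_of_forall_le
    (s := (fun q : ℝ × ℝ => (q.2 - d) / (q.1 - m)) '' {q ∈ K | m < q.1})
    (t := (fun p : ℝ × ℝ => (d - p.2) / (m - p.1)) '' {p ∈ K | p.1 < m})
    ⟨_, q₀, ⟨hq₀, hmq₀⟩, rfl⟩ ⟨_, p₀, ⟨hp₀, hpm₀⟩, rfl⟩ (by
      rintro _ ⟨q, ⟨hq, hmq⟩, rfl⟩ _ ⟨p, ⟨hp, hpm⟩, rfl⟩
      exact div_sub_le_div_sub_of_convex hK hd hp hq hpm hmq)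
  refine ⟨γ, fun q hq => ?_⟩
  rcases lt_trichotomy q.1 m with hqm | hqm | hmq
  · have hγ := hleft ⟨q, ⟨hq, hqm⟩, rfl⟩
    rw [le_div_iff₀ (sub_pos.2 hqm)] at hγ
    linarith
  · simpa [hqm] using hd q hq hqm
  · have hγ := hright ⟨q, ⟨hq, hmq⟩, rfl⟩
    rw [div_le_iff₀ (sub_pos.2 hmq)] at hγ
    linarith

end SupportingLine

section StrongDuality

lemma iSup_sub_le_coe_iff {ι : Type*} (f : ι → ℝ) (s : EReal) (γ : ℝ) :
    (⨆ x, (f x : EReal)) - s ≤ γ ↔ ∀ x, ((f x - γ : ℝ) : EReal) ≤ s := by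
  rw [EReal.sub_le_iff_le_add (.inr (EReal.coe_ne_top γ)) (.inr (EReal.coe_ne_bot γ)),
    iSup_le_iff]
  refine forall_congr' fun x => ?_
  rw [EReal.coe_sub, EReal.sub_le_iff_le_add (.inl (EReal.coe_ne_bot γ))
    (.inl (EReal.coe_ne_top γ)), add_comm]

variable {X : Type*} [MeasurableSpace X] {φ : ℝ → EReal} {f : X → ℝ} {a b d γ : ℝ}

lemma integral_sub_tightConj_le_fDiv (φ : ℝ → EReal) (μ : ProbabilityMeasure X) (ν : Measure X)
    (f : X → ℝ) : ((∫ x, f x ∂(μ : Measure X) : ℝ) : EReal) - tightConj φ ν f ≤ fDiv φ μ ν :=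
  coe_sub_le_comm.1 (le_iSup (fun ξ : ProbabilityMeasure X =>
    ((∫ x, f x ∂(ξ : Measure X) : ℝ) : EReal) - fDiv φ ξ ν) μ)

variable {ν : Measure X} [IsProbabilityMeasure ν]

namespace IsEntropy

variable (hφ : IsEntropy φ)
include hφ

lemma tightConj_le (hf : Measurable f) (hab : ∀ x, f x ∈ Set.Icc a b)
    (hγ : ∀ x, ((f x - γ : ℝ) : EReal) ≤ slopeAtTop φ) :
    tightConj φ ν f ≤ eintegral ν (fun x => conjugate φ (f x - γ)) + γ := by
  refine iSup_le fun ξ => EReal.sub_le_of_le_add ?_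
  have hweak := hφ.coe_integral_le_eintegral_conjugate_add_fDiv (ξ := (ξ : Measure X)) (ν := ν)
    (hf.sub_const γ) (fun x => ⟨sub_le_sub_right (hab x).1 γ, sub_le_sub_right (hab x).2 γ⟩) hγ
  rw [integral_sub (integrable_of_mem_Icc hf hab) (integrable_const γ), integral_const,
    probReal_univ, one_smul, EReal.coe_sub, EReal.sub_le_iff_le_add
      (.inl (EReal.coe_ne_bot γ)) (.inl (EReal.coe_ne_top γ))] at hweak
  rwa [add_right_comm] at hweak

lemma exists_tightConj_eq_coe (h₁ : 1 ∈ effDom φ) (hf : Measurable f)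
    (hab : ∀ x, f x ∈ Set.Icc a b) : ∃ r : ℝ, tightConj φ ν f = r := by
  obtain ⟨s, hs⟩ := hφ.exists_lt_slopeAtTop
  have hI (x : X) : f x - (b - s) ∈ Set.Icc (a - (b - s)) s :=
    ⟨by linarith [(hab x).1], by linarith [(hab x).2]⟩
  have hadm : IsAdmissible φ fun x => f x - (b - s) := ⟨hf.sub_const _, _, s, hs, hI⟩
  have hup := hφ.tightConj_le (ν := ν) hf hab fun x => (hadm.lt_slopeAtTop x).le
  rw [hφ.eintegral_conjugate hadm, ← EReal.coe_add] at hup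
  obtain ⟨q, hq, hq₁⟩ := hφ.exists_mem_payoffSet (ν := ν) (f := f) h₁
  have hlow := le_tightConj_of_mem_payoffSet hq hq₁
  exact ⟨_, (EReal.coe_toReal (hup.trans_lt (EReal.coe_lt_top _)).ne
    ((EReal.bot_lt_coe _).trans_le hlow).ne').symm⟩

lemma exists_slope_payoffSet (h₁ : effDom φ = {1} ∨ effDom φ ∈ nhds 1) (hf : Measurable f)
    (hab : ∀ x, f x ∈ Set.Icc a b) (hd : tightConj φ ν f = d) :
    ∃ γ : ℝ, ∀ q ∈ payoffSet φ ν f, q.2 ≤ d + γ * (q.1 - 1) := by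
  refine exists_supporting_slope (hφ.convex_payoffSet hf hab) (fun q hq hq₁ =>
    EReal.coe_le_coe_iff.1 ((le_tightConj_of_mem_payoffSet hq hq₁).trans_eq hd))
    (h₁.imp (fun h₁ => ?_) fun h₁ => ⟨?_, ?_⟩)
  · rintro q ⟨ξ, hξ, hmass, hv⟩
    rw [← hmass, hφ.measureReal_univ_eq_of_effDom_subset h₁.subset hv, probReal_univ, mul_one]
  · obtain ⟨r, hr₁, hr⟩ := Eventually.exists_lt h₁
    obtain ⟨q, hq, rfl⟩ := hφ.exists_mem_payoffSet (ν := ν) (f := f) hr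
    exact ⟨q, hq, hr₁⟩
  · obtain ⟨r, hr₁, hr⟩ := Eventually.exists_gt h₁
    obtain ⟨q, hq, rfl⟩ := hφ.exists_mem_payoffSet (ν := ν) (f := f) hr
    exact ⟨q, hq, hr₁⟩

lemma coe_sub_le_slopeAtTop (hf : Measurable f) (hab : ∀ x, f x ∈ Set.Icc a b)
    (hγ : ∀ q ∈ payoffSet φ ν f, q.2 ≤ d + γ * (q.1 - 1)) (x : X) :
    ((f x - γ : ℝ) : EReal) ≤ slopeAtTop φ := by
  by_contra! hlt
  obtain ⟨s, hs, hsf⟩ := EReal.lt_iff_exists_real_btwn.1 hlt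
  rw [EReal.coe_lt_coe_iff] at hsf
  obtain ⟨r, hr⟩ := hφ.proper.1
  obtain ⟨q, hq, -⟩ := hφ.exists_mem_payoffSet (ν := ν) (f := f) hr
  have hline (t : ℝ) (ht : 0 ≤ t) : t * (f x - γ - s) ≤ d + γ * (q.1 - 1) - q.2 := by
    have hle := hγ _ (hφ.add_mem_payoffSet hf hab hs.le hq ht x)
    simp only at hle
    linarith
  have hpos : 0 < f x - γ - s := by linarith
  have hC : 0 ≤ d + γ * (q.1 - 1) - q.2 := by simpa using hline 0 le_rfl
  have habs := hline ((d + γ * (q.1 - 1) - q.2 + 1) / (f x - γ - s)) (by positivity)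
  rw [div_mul_cancel₀ _ hpos.ne'] at habs
  linarith

lemma eintegral_conjugate_sub_le (hf : Measurable f) (hab : ∀ x, f x ∈ Set.Icc a b)
    (hγ : ∀ q ∈ payoffSet φ ν f, q.2 ≤ d + γ * (q.1 - 1)) :
    eintegral ν (fun x => conjugate φ (f x - γ)) ≤ (d - γ : ℝ) := by
  by_contra! hlt
  have : Nonempty (epi φ) := nonempty_subtype.2 hφ.exists_mem_epi
  have hfν : Integrable f ν := integrable_of_mem_Icc hf hab
  simp only [conjugate_eq_iSup_epi] at hlt
  obtain ⟨w, hw⟩ := exists_simpleFunc_lt_integral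
    (F := fun x (p : epi φ) => (f x - γ) * p.1.1 - p.1.2)
    (fun p => ((hf.sub_const γ).mul_const _).sub_const _)
    (fun p => ((hfν.sub (integrable_const γ)).mul_const _).sub (integrable_const _))
    (fun x => by fun_prop) hlt
  have hρ : Integrable (fun x => (w x).1.1) ν :=
    integrable_simpleFunc_eval (fun p : epi φ => integrable_const p.1.1) w
  have hc : Integrable (fun x => (w x).1.2) ν :=
    integrable_simpleFunc_eval (fun p : epi φ => integrable_const p.1.2) w
  have hρf : Integrable (fun x => (w x).1.1 * f x) ν :=
    integrable_simpleFunc_eval (fun p : epi φ => hfν.const_mul p.1.1) w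
  have hle := hγ _ (hφ.withDensity_mem_payoffSet (ρ := fun x => (w x).1.1)
    (w.map fun p : epi φ => p.1.1).measurable hρ hc
    fun x => (w x).2)
  have hργ : Integrable (fun x => (w x).1.1 * f x - γ * (w x).1.1) ν :=
    hρf.sub (hρ.const_mul γ)
  have hsplit : ∫ x, ((f x - γ) * (w x).1.1 - (w x).1.2) ∂ν
      = ∫ x, (w x).1.1 * f x ∂ν - γ * ∫ x, (w x).1.1 ∂ν - ∫ x, (w x).1.2 ∂ν := by
    rw [← integral_const_mul, ← integral_sub hρf (hρ.const_mul γ),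
      ← integral_sub hργ hc]
    congr with x
    ring
  simp only at hle
  linarith

theorem isLeast_tightConj (h₁ : effDom φ = {1} ∨ effDom φ ∈ nhds 1) (hf : Measurable f)
    (hab : ∀ x, f x ∈ Set.Icc a b) :
    IsLeast ((fun γ : ℝ => eintegral ν (fun x => conjugate φ (f x - γ)) + (γ : EReal)) ''
      {γ : ℝ | (⨆ x, (f x : EReal)) - slopeAtTop φ ≤ γ}) (tightConj φ ν f) := by
  simp only [iSup_sub_le_coe_iff]
  refine ⟨?_, ?_⟩
  · obtain ⟨d, hd⟩ := hφ.exists_tightConj_eq_coe (ν := ν)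
      (h₁.elim (fun h => h.ge rfl) mem_of_mem_nhds) hf hab
    obtain ⟨γ, hγ⟩ := hφ.exists_slope_payoffSet h₁ hf hab hd
    have hs := hφ.coe_sub_le_slopeAtTop hf hab hγ
    refine ⟨γ, hs, le_antisymm ?_ (hφ.tightConj_le hf hab hs)⟩
    rw [hd]
    calc eintegral ν (fun x => conjugate φ (f x - γ)) + γ ≤ (d - γ : ℝ) + γ :=
        add_le_add_left (hφ.eintegral_conjugate_sub_le hf hab hγ) _
      _ = d := by rw [← EReal.coe_add, sub_add_cancel]
  · rintro _ ⟨γ, hγ, rfl⟩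
    exact hφ.tightConj_le hf hab hγ

end IsEntropy

end StrongDuality

section LipschitzDensity

variable {X : Type*} [MetricSpace X] {f : X → ℝ} {a b : ℝ}

lemma sub_const_mem_Lip (hf : f ∈ Lip X) (c : ℝ) : (fun x => f x - c) ∈ Lip X :=
  hf.imp fun K hK => LipschitzWith.of_dist_le_mul fun x y => by
    simpa only [dist_sub_right] using hK.dist_le_mul x y

lemma exists_forall_mem_Icc_of_mem_Lip [CompactSpace X] (hf : f ∈ Lip X) :
    ∃ a b : ℝ, ∀ x, f x ∈ Set.Icc a b := by
  obtain ⟨K, hK⟩ := hf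
  obtain ⟨C, hC⟩ := (isCompact_range hK.continuous).isBounded.exists_norm_le
  exact ⟨-C, C, fun x => abs_le.1 (hC _ ⟨x, rfl⟩)⟩

lemma separatesPointsStrongly_Lip : {f : C(X, ℝ) | ⇑f ∈ Lip X}.SeparatesPointsStrongly := by
  intro v x y
  have hlip : LipschitzWith (‖(v y - v x) / dist x y‖₊ * 1)
      fun z => v x + (v y - v x) / dist x y * dist z x := by
    refine (LipschitzWith.of_dist_le_mul fun z w => ?_)
    rw [dist_add_left, ← smul_eq_mul, ← smul_eq_mul, dist_smul₀, mul_one]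
    gcongr
    · rfl
    · exact (LipschitzWith.dist_left x).dist_le_mul z w |>.trans_eq (one_mul _)
  refine ⟨⟨_, hlip.continuous⟩, ⟨_, hlip⟩, by simp, ?_⟩
  rcases eq_or_ne x y with rfl | hxy
  · simp
  · simp [dist_comm y x, div_mul_cancel₀ _ (dist_ne_zero.2 hxy)]

lemma dense_setOf_mem_Lip [CompactSpace X] : Dense {f : C(X, ℝ) | ⇑f ∈ Lip X} :=
  dense_iff_closure_eq.2 <| ContinuousMap.sublattice_closure_eq_top _
    ⟨0, 0, LipschitzWith.const 0⟩
    (fun _ ⟨_, hf⟩ _ ⟨_, hg⟩ => ⟨_, hf.min hg⟩)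
    (fun _ ⟨_, hf⟩ _ ⟨_, hg⟩ => ⟨_, hf.max hg⟩) separatesPointsStrongly_Lip

variable [MeasurableSpace X] [BorelSpace X]

lemma measurable_of_mem_Lip (hf : f ∈ Lip X) : Measurable f :=
  hf.elim fun _ hK => hK.continuous.measurable

lemma exists_seq_mem_Lip_tendsto_ae [CompactSpace X] {l : Measure X} [IsFiniteMeasure l]
    {g : X → ℝ} (hg : Integrable g l) :
    ∃ f : ℕ → X → ℝ, (∀ n, f n ∈ Lip X) ∧
      ∀ᵐ x ∂l, Tendsto (fun n => f n x) atTop (nhds (g x)) := by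
  have hdense := (ContinuousMap.toLp_denseRange ℝ l ℝ ENNReal.one_ne_top).dense_image
    (map_continuous _) dense_setOf_mem_Lip
  obtain ⟨F, hF, hlim⟩ := mem_closure_iff_seq_limit.1
    (hdense ((memLp_one_iff_integrable.2 hg).toLp g))
  choose f hf hfF using hF
  obtain ⟨u, -, hu⟩ := (tendstoInMeasure_of_tendsto_Lp hlim).exists_seq_tendsto_ae
  refine ⟨fun n => f (u n), fun n => hf _, ?_⟩
  filter_upwards [hu, (memLp_one_iff_integrable.2 hg).coeFn_toLp,
    ae_all_iff.2 fun n => ContinuousMap.coeFn_toLp (p := 1) (𝕜 := ℝ) l (f n)] with x hx hgx hfx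
  simpa only [← hfF, hfx, hgx] using hx

lemma exists_seq_mem_Lip_Icc_tendsto_ae [CompactSpace X] {l : Measure X} [IsFiniteMeasure l]
    {g : X → ℝ} (hg : Measurable g) (hle : a ≤ b) (hab : ∀ x, g x ∈ Set.Icc a b) :
    ∃ f : ℕ → X → ℝ, (∀ n, f n ∈ Lip X) ∧ (∀ n x, f n x ∈ Set.Icc a b) ∧
      ∀ᵐ x ∂l, Tendsto (fun n => f n x) atTop (nhds (g x)) := by
  obtain ⟨f, hf, hlim⟩ := exists_seq_mem_Lip_tendsto_ae (integrable_of_mem_Icc (ν := l) hg hab)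
  refine ⟨fun n x => Set.projIcc a b hle (f n x), fun n => (hf n).imp fun K hK =>
    ?_, fun n x => Subtype.coe_prop _, ?_⟩
  · simpa using! (LipschitzWith.subtype_val _).comp ((LipschitzWith.projIcc hle).comp hK)
  · filter_upwards [hlim] with x hx
    have hc : Continuous fun t : ℝ => (Set.projIcc a b hle t : ℝ) := by fun_prop
    simpa only [Set.projIcc_of_mem hle (hab x), Function.comp_def] using (hc.tendsto (g x)).comp hx

end LipschitzDensity

section LipschitzDuality

variable {X : Type*} [MetricSpace X] [CompactSpace X] [MeasurableSpace X] [BorelSpace X]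
  {φ : ℝ → EReal} {ξ ν : Measure X} {M : ℝ}

namespace IsEntropy

variable (hφ : IsEntropy φ)
include hφ

lemma exists_mem_Lip_lt_of_lt_fDiv [IsFiniteMeasure ξ] [IsFiniteMeasure ν]
    (hM : (M : EReal) < fDiv φ ξ ν) :
    ∃ f ∈ Lip X, IsAdmissible φ f ∧
      M < ∫ x, f x ∂ξ - ∫ x, (conjugate φ (f x)).toReal ∂ν := by
  obtain ⟨g, hg, hlt⟩ := hφ.exists_isAdmissible_lt_of_lt_fDiv hM
  obtain ⟨a, b, hb, hab⟩ := hg.exists_bounds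
  obtain hX | ⟨⟨x₀⟩⟩ := isEmpty_or_nonempty X
  · exact ⟨g, ⟨0, .of_dist_le_mul isEmptyElim⟩, hg, hlt⟩
  obtain ⟨f, hf, hfab, hlim⟩ := exists_seq_mem_Lip_Icc_tendsto_ae (l := ξ + ν) hg.measurable
    ((hab x₀).1.trans (hab x₀).2) hab
  rw [ae_add_measure_iff] at hlim
  have hadm (n : ℕ) : IsAdmissible φ (f n) := ⟨measurable_of_mem_Lip (hf n), a, b, hb, hfab n⟩
  have h₁ : Tendsto (fun n => ∫ x, f n x ∂ξ) atTop (nhds (∫ x, g x ∂ξ)) :=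
    tendsto_integral_of_dominated_convergence (fun _ => max |a| |b|)
      (fun n => (hadm n).integrable.aestronglyMeasurable) (integrable_const _)
      (fun n => .of_forall fun x => abs_le_max_abs_abs (hfab n x).1 (hfab n x).2) hlim.1
  have h₂ : Tendsto (fun n => ∫ x, (conjugate φ (f n x)).toReal ∂ν) atTop
      (nhds (∫ x, (conjugate φ (g x)).toReal ∂ν)) := by
    refine tendsto_integral_of_dominated_convergence
      (fun _ => max |(conjugate φ a).toReal| |(conjugate φ b).toReal|)
      (fun n => (hφ.integrable_toReal_conjugate (hadm n)).aestronglyMeasurable)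
      (integrable_const _)
      (fun n => .of_forall fun x => ?_) (hlim.2.mono fun x hx => ?_)
    · have hx := hφ.toReal_conjugate_mem_Icc hb (hfab n x)
      exact abs_le_max_abs_abs hx.1 hx.2
    · have hopen : IsOpen {y : ℝ | (y : EReal) < slopeAtTop φ} :=
        isOpen_Iio.preimage continuous_coe_real_ereal
      exact ((hφ.continuousOn_toReal_conjugate.continuousAt
        (hopen.mem_nhds (hg.lt_slopeAtTop x))).tendsto).comp hx
  obtain ⟨n, hn⟩ := ((h₁.sub h₂).eventually_const_lt hlt).exists
  exact ⟨f n, hf n, hadm n, hn⟩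

lemma exists_mem_LipAt_le_integral_sub_tightConj [IsProbabilityMeasure ξ]
    [IsProbabilityMeasure ν] (x₀ : X) (hM : (M : EReal) < fDiv φ ξ ν) :
    ∃ f ∈ LipAt x₀, (M : EReal) ≤ ((∫ x, f x ∂ξ : ℝ) : EReal) - tightConj φ ν f := by
  obtain ⟨g, hg, hadm, hlt⟩ := hφ.exists_mem_Lip_lt_of_lt_fDiv hM
  obtain ⟨a, b, hab⟩ := exists_forall_mem_Icc_of_mem_Lip hg
  refine ⟨fun x => g x - g x₀, ⟨sub_const_mem_Lip hg _, sub_self _⟩, ?_⟩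
  have hle := hφ.tightConj_le (ν := ν) (γ := -g x₀) (hadm.measurable.sub_const (g x₀))
    (fun x => ⟨sub_le_sub_right (hab x).1 _, sub_le_sub_right (hab x).2 _⟩)
    fun x => by simpa using (hadm.lt_slopeAtTop x).le
  simp only [sub_neg_eq_add, sub_add_cancel] at hle
  rw [hφ.eintegral_conjugate hadm, ← EReal.coe_add] at hle
  refine le_trans ?_ (EReal.sub_le_sub le_rfl hle)
  rw [integral_sub hadm.integrable (integrable_const _), integral_const, probReal_univ, one_smul,
    ← EReal.coe_sub, EReal.coe_le_coe_iff]
  linarith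

theorem fDiv_eq_iSup_LipAt (μ ν : ProbabilityMeasure X) (x₀ : X) :
    fDiv φ (μ : Measure X) (ν : Measure X) = ⨆ f ∈ LipAt x₀,
      ((∫ x, f x ∂(μ : Measure X) : ℝ) : EReal) - tightConj φ (ν : Measure X) f := by
  refine le_antisymm (EReal.ge_of_forall_gt_iff_ge.1 fun M hM => ?_)
    (iSup₂_le fun f _ => integral_sub_tightConj_le_fDiv φ μ ν f)
  obtain ⟨f, hf, hle⟩ := hφ.exists_mem_LipAt_le_integral_sub_tightConj x₀ hM
  exact hle.trans (le_iSup₂_of_le f hf le_rfl)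

theorem fDiv_eq_iSup_Lip (μ ν : ProbabilityMeasure X) :
    fDiv φ (μ : Measure X) (ν : Measure X) = ⨆ f ∈ Lip X,
      ((∫ x, f x ∂(μ : Measure X) : ℝ) : EReal) - tightConj φ (ν : Measure X) f := by
  obtain ⟨x₀⟩ := ν.nonempty
  refine le_antisymm ?_ (iSup₂_le fun f _ => integral_sub_tightConj_le_fDiv φ μ ν f)
  rw [hφ.fDiv_eq_iSup_LipAt μ ν x₀]
  exact biSup_mono fun f hf => hf.1

end IsEntropy

end LipschitzDuality

end FDivergence

open FDivergence in
theorem proposition1_general {X : Type*} [MetricSpace X] [CompactSpace X] [MeasurableSpace X]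
    [BorelSpace X] (μ ν : ProbabilityMeasure X) {φ : ℝ → EReal}
    (hbot : ∀ x, ⊥ < φ x) (hconvex : IsConvex φ) (hlsc : LowerSemicontinuous φ)
    (hri : (1 : ℝ) ∈ intrinsicInterior ℝ (effDom φ)) :
    fDiv φ (μ : Measure X) (ν : Measure X) =
      (⨆ f ∈ Lip X, (((∫ x, f x ∂(μ : Measure X) : ℝ) : EReal) - tightConj φ (ν : Measure X) f)) ∧
    (∀ x₀ : X, fDiv φ (μ : Measure X) (ν : Measure X) =
      (⨆ f ∈ LipAt x₀,
        (((∫ x, f x ∂(μ : Measure X) : ℝ) : EReal) - tightConj φ (ν : Measure X) f))) ∧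
    (∀ f ∈ Lip X,
      (∃ r : ℝ, tightConj φ (ν : Measure X) f = (r : EReal)) ∧
      IsLeast
        ((fun γ : ℝ => eintegral (ν : Measure X) (fun x => conjugate (plusPart φ) (f x - γ))
            + (γ : EReal)) ''
          {γ : ℝ | (⨆ x : X, (f x : EReal)) - slopeAtTop φ ≤ (γ : EReal)})
        (tightConj φ (ν : Measure X) f)) := by
  have hφ : IsEntropy (plusPart φ) :=
    isEntropy_plusPart hbot hconvex hlsc zero_le_one (intrinsicInterior_subset hri)
  have h₁ := effDom_plusPart_eq_singleton_or_mem_nhds hbot one_pos hri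
  have hdom : 1 ∈ effDom (plusPart φ) := h₁.elim (fun h => h.ge rfl) mem_of_mem_nhds
  simp only [← fDiv_plusPart φ, ← tightConj_plusPart φ, ← slopeAtTop_plusPart φ]
  refine ⟨hφ.fDiv_eq_iSup_Lip μ ν, hφ.fDiv_eq_iSup_LipAt μ ν, fun f hf => ?_⟩
  obtain ⟨a, b, hab⟩ := exists_forall_mem_Icc_of_mem_Lip hf
  exact ⟨hφ.exists_tightConj_eq_coe hdom (measurable_of_mem_Lip hf) hab,
    hφ.isLeast_tightConj h₁ (measurable_of_mem_Lip hf) hab⟩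

theorem proposition1 {X : Type*} [MetricSpace X] [CompactSpace X] [MeasurableSpace X]
    [BorelSpace X] (μ ν : ProbabilityMeasure X) (φ : ℝ → EReal)
    (hproper : FDivergence.IsProper φ) (hconvex : FDivergence.IsConvex φ)
    (hlsc : LowerSemicontinuous φ) (hstrict : FDivergence.IsStrictlyConvexAt φ 1)
    (hone : φ 1 = 0) (hri : (1 : ℝ) ∈ intrinsicInterior ℝ (FDivergence.effDom φ)) :
    FDivergence.fDiv φ (μ : Measure X) (ν : Measure X) =
      (⨆ f ∈ FDivergence.Lip X,
        (((∫ x, f x ∂(μ : Measure X) : ℝ) : EReal)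
          - FDivergence.tightConj φ (ν : Measure X) f)) ∧
    (∀ x₀ : X, FDivergence.fDiv φ (μ : Measure X) (ν : Measure X) =
      (⨆ f ∈ FDivergence.LipAt x₀,
        (((∫ x, f x ∂(μ : Measure X) : ℝ) : EReal)
          - FDivergence.tightConj φ (ν : Measure X) f))) ∧
    (∀ f ∈ FDivergence.Lip X,
      (∃ r : ℝ, FDivergence.tightConj φ (ν : Measure X) f = (r : EReal)) ∧
      IsLeast
        ((fun γ : ℝ =>
            FDivergence.eintegral (ν : Measure X)
              (fun x => FDivergence.conjugate (FDivergence.plusPart φ) (f x - γ))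
            + (γ : EReal)) ''
          {γ : ℝ | (⨆ x : X, (f x : EReal)) - FDivergence.slopeAtTop φ ≤ (γ : EReal)})
        (FDivergence.tightConj φ (ν : Measure X) f)) :=
  proposition1_general μ ν hproper.2 hconvex hlsc hri
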